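/- Let $q\in\mathbb{C}$ with $0<|q|<1$. Write $(x;q)_n=\prod_{i=0}^{n-1}(1-q^ix)$, $(x;q)_\infty=\prod_{i\ge0}(1-q^ix)$, $$j(x;q)=(x;q)_\infty\,(q/x;q)_\infty\,(q;q)_\infty,$$ $$g_{a,b,c}(x,y;q)=\Big(\sum_{r,s\ge0}+\sum_{r,s<0}\Big)(-1)^{r+s}x^ry^sq^{a\binom r2+brs+c\binom s2}\qquad(r,s\in\mathbb{Z}),$$ where $\binom r2=r(r-1)/2$, and $$G(q)=q\,g_{1,3,1}(q^6,q^6;q^4)+g_{1,3,1}(q^2,q^2;q^4)+q^4g_{1,3,1}(q^{10},q^{10};q^4)+q^9g_{1,3,1}(q^{14},q^{14};q^4).$$ Then all the series and products below converge (the series over $n$ and the double series over $(r,s)$ defining the functions $g_{1,3,1}$ absolutely), and $$\begin{aligned} \sum_{n=1}^\infty\frac{q^{n^2}}{(-q;q^2)_n(1+q^{2n})} &=\sum_{n=1}^\infty\frac{(-1)^{n-1}q^n(q^2;q^2)_{n-1}}{(-q^2;q^2)_n}\\ &=\sum_{n=1}^\infty\ \sum_{m\in\mathbb{Z},\,|m|\le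 n/2}(-1)^mq^{n^2-2m^2}-\sum_{n=1}^\infty(-1)^nq^{2n^2}\\ &=\tfrac12\{G(q)+j(q^2;q^4)\}-1-\sum_{n=1}^\infty(-1)^nq^{2n^2}\\ &=\tfrac12\{G(q)-1\}. \end{aligned}$$ -/

import Mathlib

noncomputable section

/-- The finite `q`-Pochhammer symbol `(x; q)_n = ∏_{i=0}^{n-1} (1 - q^i x)`. -/
def qPoch (x q : ℂ) (n : ℕ) : ℂ := ∏ i ∈ Finset.range n, (1 - q ^ i * x)

/-- The infinite `q`-Pochhammer symbol `(x; q)_∞ = ∏_{i ≥ 0} (1 - q^i x)`. -/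
def qPochInf (x q : ℂ) : ℂ := ∏' i : ℕ, (1 - q ^ i * x)

/-- The theta function `j(x; q) = (x; q)_∞ (q/x; q)_∞ (q; q)_∞`. -/
def thetaJ (x q : ℂ) : ℂ := qPochInf x q * qPochInf (q / x) q * qPochInf q q

/-- The general term `(-1)^{r+s} x^r y^s q^{a C(r,2) + b r s + c C(s,2)}` of a Hecke-type
double-sum, for integers `r`, `s` of any sign, with `C(r,2) = r (r - 1) / 2` (an exact division). -/
def heckeTerm (a b c : ℤ) (x y q : ℂ) (r s : ℤ) : ℂ :=
  (-1) ^ (r + s) * x ^ r * y ^ s *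
    q ^ (a * (r * (r - 1) / 2) + b * r * s + c * (s * (s - 1) / 2))

/-- The double-sum of type II symmetry,
`g_{a,b,c}(x,y;q) = (∑_{r,s ≥ 0} + ∑_{r,s < 0}) (-1)^{r+s} x^r y^s q^{a C(r,2) + b r s + c C(s,2)}`;
a pair of negative integers is written `(-(k + 1), -(l + 1))` with `k`, `l` natural numbers. -/
def heckeG (a b c : ℤ) (x y q : ℂ) : ℂ :=
  (∑' p : ℕ × ℕ, heckeTerm a b c x y q p.1 p.2) +
    ∑' p : ℕ × ℕ, heckeTerm a b c x y q (-((p.1 : ℤ) + 1)) (-((p.2 : ℤ) + 1))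

/-- Both of the double series in the definition of `g_{a,b,c}(x,y;q)` converge (absolutely). -/
def HeckeConverges (a b c : ℤ) (x y q : ℂ) : Prop :=
  (Summable fun p : ℕ × ℕ => heckeTerm a b c x y q p.1 p.2) ∧
    Summable fun p : ℕ × ℕ => heckeTerm a b c x y q (-((p.1 : ℤ) + 1)) (-((p.2 : ℤ) + 1))

/-- The inner sum `∑_{|m| ≤ n/2} (-1)^m q^{n^2 - 2 m^2}`, over integers `m`. -/
def innerSum (q : ℂ) (n : ℕ) : ℂ :=
  ∑ m ∈ Finset.Icc (-((n : ℤ) / 2)) ((n : ℤ) / 2), (-1) ^ m * q ^ ((n : ℤ) ^ 2 - 2 * m ^ 2)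

end

/-! Write Q = q² and let F(b,c;z) be Fine's series in base Q. The second series is q/(1+q²) ·
F(q²,-q⁴;-q) term by term. Iterating the functional equation that shifts c and z together
(`one_sub_mul_fineSum`) turns the same value into the first series. Iterating one that shifts z
alone (`one_sub_mul_fineSum_self`) turns it into a third series, ∑ (-1)^k q^{2k+1} (q;Q)_k /
(-q;Q)_{k+1}.

The third series is half the alternating sum of the differences of ρ_k = (q;Q)_k / (-q;Q)_k. A
finite Jacobi triple product expands ρ_n as ∑_a (-1)^a q^{a²} `conjTerm q a n`, a Bailey-type
expansion. After the sums are exchanged, what remains is the alternating sum over n of `conjTerm q a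
n`, which exists only in Abel's sense. It obeys a first-order recurrence in a (`conjSum_sub`), whose
bounded solution is a partial theta series (`conjSum_eq`). This produces the indefinite form n² -
2m² on the cone 2|m| ≤ n.

Let C be the sum of (-1)^m q^{n²-2m²} over that cone and T = ∑_{b≥0} (-1)^b q^{2b²}. The third
series is C - T, and j(q²;q⁴) = 2T - 1 by the triple product. In G the four quadrant sums with r,s ≥
0 tile the cone according to n - 2|m| mod 4. Those with r,s < 0 tile the cone without its boundary
rays, which carry 2T - 1. Hence G = 2C - (2T - 1), and all the stated equalities follow. -/

/-! ### Uniform bounds for q-Pochhammer products and their inverses. -/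

lemma qPoch_zero (x q : ℂ) : qPoch x q 0 = 1 := by simp [qPoch]

lemma qPoch_succ (x q : ℂ) (n : ℕ) : qPoch x q (n + 1) = qPoch x q n * (1 - q ^ n * x) := by
  simp [qPoch, Finset.prod_range_succ]

lemma qPoch_succ' (x q : ℂ) (n : ℕ) : qPoch x q (n + 1) = (1 - x) * qPoch (q * x) q n := by
  simp only [qPoch, Finset.prod_range_succ', pow_zero, one_mul]
  rw [mul_comm]
  congr 1
  exact Finset.prod_congr rfl fun i _ => by ring

/-- A common bound for a product `∏ (1 - y i)`, `‖y i‖ ≤ ρ ^ (i + 1)`, and its inverse. -/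
noncomputable def prodBound (ρ : ℝ) : ℝ := Real.exp (1 / (1 - ρ) ^ 2)

lemma prodBound_pos (ρ : ℝ) : 0 < prodBound ρ := Real.exp_pos _

lemma sum_pow_succ_le {ρ : ℝ} (h0 : 0 ≤ ρ) (h1 : ρ < 1) (n : ℕ) :
    ∑ i ∈ Finset.range n, ρ ^ (i + 1) ≤ 1 / (1 - ρ) := by
  have h : ∑ i ∈ Finset.range n, ρ ^ (i + 1) ≤ ∑ i ∈ Finset.range n, ρ ^ i :=
    Finset.sum_le_sum fun i _ => pow_le_pow_of_le_one h0 h1.le (Nat.le_succ i)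
  refine h.trans ?_
  rw [one_div, ← tsum_geometric_of_lt_one h0 h1]
  exact (summable_geometric_of_lt_one h0 h1).sum_le_tsum _ fun i _ => pow_nonneg h0 i

lemma norm_prod_one_sub_le {ρ : ℝ} (h0 : 0 ≤ ρ) (h1 : ρ < 1) {y : ℕ → ℂ}
    (hy : ∀ i, ‖y i‖ ≤ ρ ^ (i + 1)) (n : ℕ) :
    ‖∏ i ∈ Finset.range n, (1 - y i)‖ ≤ prodBound ρ := by
  have hρ : 0 < 1 - ρ := by linarith
  calc ‖∏ i ∈ Finset.range n, (1 - y i)‖ = ∏ i ∈ Finset.range n, ‖1 - y i‖ := norm_prod _ _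
    _ ≤ ∏ i ∈ Finset.range n, Real.exp (ρ ^ (i + 1)) := by
        refine Finset.prod_le_prod (fun _ _ => norm_nonneg _) fun i _ => ?_
        have := norm_sub_le (1 : ℂ) (y i)
        rw [norm_one] at this
        linarith [hy i, Real.add_one_le_exp (ρ ^ (i + 1))]
    _ = Real.exp (∑ i ∈ Finset.range n, ρ ^ (i + 1)) := (Real.exp_sum _ _).symm
    _ ≤ prodBound ρ := by
        refine Real.exp_le_exp.2 ((sum_pow_succ_le h0 h1 n).trans ?_)
        exact one_div_le_one_div_of_le (by positivity) (by nlinarith)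

/-- For t = ρ^(i+1) ≤ ρ one has 1/(1-t) = 1 + t/(1-t) ≤ exp(t/(1-ρ)). Multiplying over i gives the
total exponent 1/(1-ρ)² that defines `prodBound`. The form without division also passes to the limit
and shows that the infinite product is nonzero. -/
lemma one_le_prodBound_mul_norm_prod {ρ : ℝ} (h0 : 0 ≤ ρ) (h1 : ρ < 1) {y : ℕ → ℂ}
    (hy : ∀ i, ‖y i‖ ≤ ρ ^ (i + 1)) (n : ℕ) :
    1 ≤ prodBound ρ * ‖∏ i ∈ Finset.range n, (1 - y i)‖ := by
  have hρ : 0 < 1 - ρ := by linarith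
  have key : ∀ i, Real.exp (-(ρ ^ (i + 1) / (1 - ρ))) ≤ ‖1 - y i‖ := fun i => by
    have h2 := norm_sub_norm_le (1 : ℂ) (y i)
    rw [norm_one] at h2
    have h3 : ρ ^ (i + 1) ≤ ρ := by
      simpa using pow_le_pow_of_le_one h0 h1.le (Nat.le_add_left 1 i)
    have h4 : 0 ≤ ρ ^ (i + 1) := by positivity
    have h5 : 1 / (1 - ρ ^ (i + 1)) ≤ Real.exp (ρ ^ (i + 1) / (1 - ρ)) := by
      have h6 := Real.add_one_le_exp (ρ ^ (i + 1) / (1 - ρ))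
      refine le_trans ?_ h6
      rw [div_add_one hρ.ne', div_le_div_iff₀ (by linarith) hρ]
      nlinarith
    rw [Real.exp_neg]
    refine le_trans ?_ (le_trans (sub_le_sub_left (hy i) 1) h2)
    rw [inv_le_comm₀ (Real.exp_pos _) (by linarith), ← one_div]
    exact h5
  have h7 : Real.exp (-(1 / (1 - ρ) ^ 2)) ≤ ‖∏ i ∈ Finset.range n, (1 - y i)‖ := by
    calc Real.exp (-(1 / (1 - ρ) ^ 2))
        ≤ Real.exp (∑ i ∈ Finset.range n, -(ρ ^ (i + 1) / (1 - ρ))) := by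
          refine Real.exp_le_exp.2 ?_
          rw [Finset.sum_neg_distrib, ← Finset.sum_div, neg_le_neg_iff, div_le_iff₀ hρ]
          refine (sum_pow_succ_le h0 h1 n).trans (le_of_eq ?_)
          field_simp
      _ = ∏ i ∈ Finset.range n, Real.exp (-(ρ ^ (i + 1) / (1 - ρ))) := Real.exp_sum _ _
      _ ≤ ∏ i ∈ Finset.range n, ‖1 - y i‖ :=
          Finset.prod_le_prod (fun _ _ => (Real.exp_pos _).le) fun i _ => key i
      _ = _ := (norm_prod _ _).symm
  calc (1 : ℝ) = prodBound ρ * Real.exp (-(1 / (1 - ρ) ^ 2)) := by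
        rw [prodBound, ← Real.exp_add]; simp
    _ ≤ _ := mul_le_mul_of_nonneg_left h7 (prodBound_pos ρ).le

lemma norm_sq_pow_mul_le {q x : ℂ} (hq : ‖q‖ < 1) (hx : ‖x‖ ≤ ‖q‖) (i : ℕ) :
    ‖(q ^ 2) ^ i * x‖ ≤ ‖q‖ ^ (i + 1) := by
  rw [norm_mul, ← pow_mul, norm_pow, pow_succ]
  exact mul_le_mul (pow_le_pow_of_le_one (norm_nonneg _) hq.le (by omega)) hx (norm_nonneg _)
    (by positivity)

lemma norm_qPoch_le {q x : ℂ} (hq : ‖q‖ < 1) (hx : ‖x‖ ≤ ‖q‖) (n : ℕ) :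
    ‖qPoch x (q ^ 2) n‖ ≤ prodBound ‖q‖ :=
  norm_prod_one_sub_le (norm_nonneg q) hq (norm_sq_pow_mul_le hq hx) n

lemma one_le_prodBound_mul_norm_qPoch {q x : ℂ} (hq : ‖q‖ < 1) (hx : ‖x‖ ≤ ‖q‖) (n : ℕ) :
    1 ≤ prodBound ‖q‖ * ‖qPoch x (q ^ 2) n‖ :=
  one_le_prodBound_mul_norm_prod (norm_nonneg q) hq (norm_sq_pow_mul_le hq hx) n

lemma qPoch_ne_zero {q x : ℂ} (hq : ‖q‖ < 1) (hx : ‖x‖ ≤ ‖q‖) (n : ℕ) :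
    qPoch x (q ^ 2) n ≠ 0 := fun h => by
  have := one_le_prodBound_mul_norm_qPoch hq hx n
  rw [h, norm_zero, mul_zero] at this
  linarith

lemma norm_inv_qPoch_le {q x : ℂ} (hq : ‖q‖ < 1) (hx : ‖x‖ ≤ ‖q‖) (n : ℕ) :
    ‖(qPoch x (q ^ 2) n)⁻¹‖ ≤ prodBound ‖q‖ := by
  rw [norm_inv, inv_le_comm₀ (norm_pos_iff.2 (qPoch_ne_zero hq hx n)) (prodBound_pos _),
    inv_le_iff_one_le_mul₀' (prodBound_pos _)]
  exact one_le_prodBound_mul_norm_qPoch hq hx n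

lemma norm_qPoch_div_le {q x y : ℂ} (hq : ‖q‖ < 1) (hx : ‖x‖ ≤ ‖q‖) (hy : ‖y‖ ≤ ‖q‖)
    (m n : ℕ) : ‖qPoch x (q ^ 2) m / qPoch y (q ^ 2) n‖ ≤ prodBound ‖q‖ ^ 2 := by
  rw [div_eq_mul_inv, norm_mul, pow_two (prodBound _)]
  exact mul_le_mul (norm_qPoch_le hq hx m) (norm_inv_qPoch_le hq hy n) (norm_nonneg _)
    (prodBound_pos _).le

lemma one_sub_ne_zero_of_norm_lt_one {x : ℂ} (hx : ‖x‖ < 1) : 1 - x ≠ 0 := fun h => by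
  rw [← sub_eq_zero.1 h, norm_one] at hx
  exact lt_irrefl _ hx

/-! ### Fine's series and two functional equations. -/

/-- Iterating `f k = A k + B k * f (k + 1)`. -/
lemma tsum_iterate_eq {f A B : ℕ → ℂ} {M : ℝ} (hf : ∀ k, ‖f k‖ ≤ M)
    (hrec : ∀ k, f k = A k + B k * f (k + 1))
    (hB : Filter.Tendsto (fun n => ∏ i ∈ Finset.range n, B i) Filter.atTop (nhds 0))
    (hs : Summable fun k => (∏ i ∈ Finset.range k, B i) * A k) :
    ∑' k, (∏ i ∈ Finset.range k, B i) * A k = f 0 := by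
  have h1 : ∀ n, ∑ k ∈ Finset.range n, (∏ i ∈ Finset.range k, B i) * A k
      = f 0 - (∏ i ∈ Finset.range n, B i) * f n := fun n => by
    induction n with
    | zero => simp
    | succ n ih =>
      rw [Finset.sum_range_succ, ih, Finset.prod_range_succ, hrec n]
      ring
  have h2 : Filter.Tendsto (fun n => (∏ i ∈ Finset.range n, B i) * f n) Filter.atTop (nhds 0) := by
    refine squeeze_zero_norm (a := fun n => ‖∏ i ∈ Finset.range n, B i‖ * M) (fun n => ?_) ?_
    · rw [norm_mul]
      exact mul_le_mul_of_nonneg_left (hf n) (norm_nonneg _)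
    · simpa using hB.norm.mul_const M
  have h3 := hs.hasSum.tendsto_sum_nat
  simp_rw [h1] at h3
  refine tendsto_nhds_unique h3 ?_
  simpa using h2.const_sub (f 0)

/-- Fine's series `∑ (b; q²)_n / (c; q²)_n z^n`. -/
noncomputable def fineSum (q b c z : ℂ) : ℂ :=
  ∑' n : ℕ, qPoch b (q ^ 2) n / qPoch c (q ^ 2) n * z ^ n

lemma norm_fineTerm_le {q b c z : ℂ} (hq : ‖q‖ < 1) (hb : ‖b‖ ≤ ‖q‖) (hc : ‖c‖ ≤ ‖q‖)
    (hz : ‖z‖ ≤ ‖q‖) (n : ℕ) :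
    ‖qPoch b (q ^ 2) n / qPoch c (q ^ 2) n * z ^ n‖ ≤ prodBound ‖q‖ ^ 2 * ‖q‖ ^ n := by
  rw [norm_mul, norm_pow]
  exact mul_le_mul (norm_qPoch_div_le hq hb hc n n) (pow_le_pow_left₀ (norm_nonneg _) hz n)
    (by positivity) (by positivity)

lemma summable_prodBound_mul_pow {q : ℂ} (hq : ‖q‖ < 1) (M : ℝ) :
    Summable fun n : ℕ => M * ‖q‖ ^ n :=
  (summable_geometric_of_lt_one (norm_nonneg _) hq).mul_left _

lemma summable_fineTerm {q b c z : ℂ} (hq : ‖q‖ < 1) (hb : ‖b‖ ≤ ‖q‖) (hc : ‖c‖ ≤ ‖q‖)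
    (hz : ‖z‖ ≤ ‖q‖) :
    Summable fun n : ℕ => qPoch b (q ^ 2) n / qPoch c (q ^ 2) n * z ^ n :=
  .of_norm_bounded (summable_prodBound_mul_pow hq _) (norm_fineTerm_le hq hb hc hz)

lemma norm_fineSum_le {q b c z : ℂ} (hq : ‖q‖ < 1) (hb : ‖b‖ ≤ ‖q‖) (hc : ‖c‖ ≤ ‖q‖)
    (hz : ‖z‖ ≤ ‖q‖) :
    ‖fineSum q b c z‖ ≤ ∑' n : ℕ, prodBound ‖q‖ ^ 2 * ‖q‖ ^ n :=
  tsum_of_norm_bounded (summable_prodBound_mul_pow hq _).hasSum (norm_fineTerm_le hq hb hc hz)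

lemma norm_pow_mul_le {q x : ℂ} (hq : ‖q‖ < 1) (hx : ‖x‖ ≤ ‖q‖) (k : ℕ) :
    ‖q ^ k * x‖ ≤ ‖q‖ := by
  rw [norm_mul, norm_pow]
  exact (mul_le_of_le_one_left (norm_nonneg _) (pow_le_one₀ (norm_nonneg _) hq.le)).trans hx

/-- Subtracting z times the series from its shift leaves the factor (1 - bQ^n) - (1 - cQ^n) = (c -
b)Q^n, with Q = q². The Q^n moves z to Qz, and splitting 1 - c off (c;Q)_{n+1} moves c to Qc. -/
lemma one_sub_mul_fineSum {q b c z : ℂ} (hq : ‖q‖ < 1) (hb : ‖b‖ ≤ ‖q‖) (hc : ‖c‖ ≤ ‖q‖)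
    (hz : ‖z‖ ≤ ‖q‖) :
    (1 - z) * fineSum q b c z =
      1 + (c - b) * z / (1 - c) * fineSum q b (q ^ 2 * c) (q ^ 2 * z) := by
  have h1 := summable_fineTerm hq hb hc hz
  have h2 : fineSum q b c z = 1 + ∑' n : ℕ,
      qPoch b (q ^ 2) (n + 1) / qPoch c (q ^ 2) (n + 1) * z ^ (n + 1) := by
    rw [fineSum, h1.tsum_eq_zero_add]
    simp [qPoch_zero]
  have h3 : (1 - z) * fineSum q b c z = 1 + ∑' n : ℕ,
      (qPoch b (q ^ 2) (n + 1) / qPoch c (q ^ 2) (n + 1) * z ^ (n + 1)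
        - z * (qPoch b (q ^ 2) n / qPoch c (q ^ 2) n * z ^ n)) := by
    rw [((summable_nat_add_iff 1).2 h1).tsum_sub (h1.mul_left z), tsum_mul_left, ← fineSum,
      sub_mul, one_mul]
    nth_rewrite 1 [h2]
    ring
  rw [h3, fineSum, ← tsum_mul_left]
  congr 1
  refine tsum_congr fun n => ?_
  have hc1 : 1 - c ≠ 0 := one_sub_ne_zero_of_norm_lt_one (hc.trans_lt hq)
  have e1 := qPoch_succ c (q ^ 2) n
  have e2 := qPoch_succ' c (q ^ 2) n
  have n1 := qPoch_ne_zero hq hc n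
  have n2 := qPoch_ne_zero hq hc (n + 1)
  have n3 : qPoch (q ^ 2 * c) (q ^ 2) n ≠ 0 := qPoch_ne_zero hq (norm_pow_mul_le hq hc 2) n
  have n4 : 1 - (q ^ 2) ^ n * c ≠ 0 := fun h => n2 (by rw [e1, h, mul_zero])
  have h4 : qPoch c (q ^ 2) n = (1 - c) * qPoch (q ^ 2 * c) (q ^ 2) n / (1 - (q ^ 2) ^ n * c) := by
    rw [eq_div_iff n4, ← e1, e2]
  rw [qPoch_succ b, e2, h4, mul_pow]
  field_simp
  ring

/-- Special to b = q², c = -q⁴: the coefficients satisfy (1 + Q^{n+2}) u_{n+1} = (1 - Q^{n+1}) u_n,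
where Q = q². Multiplying by z^{n+1} and summing involves only the values at z and Qz. -/
lemma one_sub_mul_fineSum_self {q z : ℂ} (hq : ‖q‖ < 1) (hz : ‖z‖ ≤ ‖q‖) :
    (1 - z) * fineSum q (q ^ 2) (-q ^ 4) z =
      (1 + q ^ 2) - q ^ 2 * (1 + z) * fineSum q (q ^ 2) (-q ^ 4) (q ^ 2 * z) := by
  have hb : ‖q ^ 2‖ ≤ ‖q‖ := by simpa [pow_succ] using norm_pow_mul_le hq le_rfl 1
  have hc : ‖-q ^ 4‖ ≤ ‖q‖ := by
    rw [norm_neg]; simpa [pow_succ] using norm_pow_mul_le hq le_rfl 3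
  have hz' : ‖q ^ 2 * z‖ ≤ ‖q‖ := norm_pow_mul_le hq hz 2
  have h1 := summable_fineTerm hq hb hc hz
  have h2 := summable_fineTerm hq hb hc hz'
  have key : (fineSum q (q ^ 2) (-q ^ 4) z + q ^ 2 * fineSum q (q ^ 2) (-q ^ 4) (q ^ 2 * z)) =
      (1 + q ^ 2) + z * (fineSum q (q ^ 2) (-q ^ 4) z
        - q ^ 2 * fineSum q (q ^ 2) (-q ^ 4) (q ^ 2 * z)) := by
    have e1 : (fineSum q (q ^ 2) (-q ^ 4) z + q ^ 2 * fineSum q (q ^ 2) (-q ^ 4) (q ^ 2 * z)) =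
        ∑' n : ℕ, (qPoch (q ^ 2) (q ^ 2) n / qPoch (-q ^ 4) (q ^ 2) n * z ^ n + q ^ 2 *
          (qPoch (q ^ 2) (q ^ 2) n / qPoch (-q ^ 4) (q ^ 2) n * (q ^ 2 * z) ^ n)) := by
      rw [h1.tsum_add (h2.mul_left _), tsum_mul_left]; rfl
    have e2 : z * (fineSum q (q ^ 2) (-q ^ 4) z
        - q ^ 2 * fineSum q (q ^ 2) (-q ^ 4) (q ^ 2 * z)) =
        ∑' n : ℕ, z * (qPoch (q ^ 2) (q ^ 2) n / qPoch (-q ^ 4) (q ^ 2) n * z ^ n - q ^ 2 *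
          (qPoch (q ^ 2) (q ^ 2) n / qPoch (-q ^ 4) (q ^ 2) n * (q ^ 2 * z) ^ n)) := by
      rw [tsum_mul_left, h1.tsum_sub (h2.mul_left _), tsum_mul_left]; rfl
    rw [e1, e2, (h1.add (h2.mul_left _)).tsum_eq_zero_add]
    congr 1
    · simp [qPoch_zero]
    refine tsum_congr fun n => ?_
    have n1 := qPoch_ne_zero hq hc n
    have n2 := qPoch_ne_zero hq hc (n + 1)
    have e3 := qPoch_succ (-q ^ 4) (q ^ 2) n
    have n3 : 1 + (q ^ 2) ^ n * q ^ 4 ≠ 0 := fun h => n2 (by rw [e3, mul_neg, sub_neg_eq_add, h,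
      mul_zero])
    rw [e3, qPoch_succ (q ^ 2), mul_pow, mul_pow, mul_neg, sub_neg_eq_add,
      pow_succ (q ^ 2) n]
    generalize (q ^ 2) ^ n = X at *
    have n4 : 1 + q ^ 4 * X ≠ 0 := by rwa [mul_comm]
    field_simp
    ring
  linear_combination key

/-! ### The first two series as one value of Fine's series. -/

lemma norm_neg_pow_le {q : ℂ} (hq : ‖q‖ < 1) {k : ℕ} (hk : 1 ≤ k) : ‖-q ^ k‖ ≤ ‖q‖ := by
  obtain ⟨j, rfl⟩ := Nat.exists_eq_add_of_le hk
  rw [norm_neg, add_comm, pow_succ]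
  exact norm_pow_mul_le hq le_rfl j

lemma one_add_pow_ne_zero {q : ℂ} (hq : ‖q‖ < 1) {k : ℕ} (hk : 1 ≤ k) : 1 + q ^ k ≠ 0 := by
  have := one_sub_ne_zero_of_norm_lt_one ((norm_neg_pow_le hq hk).trans_lt hq)
  rwa [sub_neg_eq_add] at this

lemma norm_inv_one_add_pow_le {q : ℂ} (hq : ‖q‖ < 1) {k : ℕ} (hk : 1 ≤ k) :
    ‖(1 + q ^ k)⁻¹‖ ≤ (1 - ‖q‖)⁻¹ := by
  rw [norm_inv]
  have h1 := norm_sub_norm_le 1 (-q ^ k)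
  rw [norm_one, sub_neg_eq_add] at h1
  exact inv_anti₀ (by linarith) (by linarith [norm_neg_pow_le hq hk])

lemma norm_pow_div_le {q : ℂ} (hq : ‖q‖ < 1) {j k l m : ℕ} (hl : 1 ≤ l) (hj : m ≤ j) :
    ‖q ^ j / (qPoch (-q) (q ^ 2) k * (1 + q ^ l))‖ ≤
      prodBound ‖q‖ * (1 - ‖q‖)⁻¹ * ‖q‖ ^ m := by
  rw [div_eq_mul_inv, mul_inv, norm_mul, norm_mul, norm_pow, mul_comm]
  have h0 : 0 < 1 - ‖q‖ := by linarith
  refine mul_le_mul (mul_le_mul (norm_inv_qPoch_le hq (by rw [norm_neg]) k)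
    (norm_inv_one_add_pow_le hq hl) (norm_nonneg _) (prodBound_pos _).le)
    (pow_le_pow_of_le_one (norm_nonneg _) hq.le hj) (by positivity) ?_
  exact mul_nonneg (prodBound_pos _).le (inv_nonneg.2 h0.le)

lemma summable_sq_series {q : ℂ} (hq : ‖q‖ < 1) : Summable fun n : ℕ =>
    q ^ ((n + 1) ^ 2) / (qPoch (-q) (q ^ 2) (n + 1) * (1 + q ^ (2 * (n + 1)))) :=
  .of_norm_bounded (summable_prodBound_mul_pow hq _) fun n =>
    norm_pow_div_le (m := n) hq (by omega) (by nlinarith)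

lemma tsum_sq_series {q : ℂ} (h0 : q ≠ 0) (hq : ‖q‖ < 1) : ∑' n : ℕ,
    q ^ ((n + 1) ^ 2) / (qPoch (-q) (q ^ 2) (n + 1) * (1 + q ^ (2 * (n + 1)))) =
      q / (1 + q ^ 2) * fineSum q (q ^ 2) (-q ^ 4) (-q) := by
  have h2 := one_add_pow_ne_zero hq (k := 2) (by omega)
  have hb : ‖q ^ 2‖ ≤ ‖q‖ := by simpa [pow_succ] using norm_pow_mul_le hq le_rfl 1
  have hc : ∀ k : ℕ, ‖-q ^ (2 * k + 4)‖ ≤ ‖q‖ := fun k => norm_neg_pow_le hq (by omega)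
  have hz : ∀ k : ℕ, ‖-q ^ (2 * k + 1)‖ ≤ ‖q‖ := fun k => norm_neg_pow_le hq (by omega)
  -- Orbit of (c, z) = (-q⁴, -q) under multiplication of both by q². In the product of the B i, the
  -- ratios (1 + q^{2i+2})/(1 + q^{2i+4}) telescope, and the exponents 2i+3 add up to n² + 2n.
  let f : ℕ → ℂ := fun k => fineSum q (q ^ 2) (-q ^ (2 * k + 4)) (-q ^ (2 * k + 1))
  let A : ℕ → ℂ := fun k => (1 + q ^ (2 * k + 1))⁻¹
  let B : ℕ → ℂ := fun k => q ^ (2 * k + 3) * (1 + q ^ (2 * k + 2)) /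
    ((1 + q ^ (2 * k + 4)) * (1 + q ^ (2 * k + 1)))
  have hP : ∀ n, ∏ i ∈ Finset.range n, B i =
      (1 + q ^ 2) * (q ^ (n ^ 2 + 2 * n) / (qPoch (-q) (q ^ 2) n * (1 + q ^ (2 * n + 2)))) := by
    intro n
    induction n with
    | zero => simp [qPoch_zero, h2]
    | succ n ih =>
      have n1 := one_add_pow_ne_zero hq (k := 2 * n + 2) (by omega)
      have n2 := one_add_pow_ne_zero hq (k := 2 * n + 4) (by omega)
      have n3 := one_add_pow_ne_zero hq (k := 2 * n + 1) (by omega)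
      have n4 : qPoch (-q) (q ^ 2) n ≠ 0 := qPoch_ne_zero hq (by rw [norm_neg]) n
      have e : 1 - (q ^ 2) ^ n * -q = 1 + q ^ (2 * n + 1) := by ring
      rw [Finset.prod_range_succ, ih, qPoch_succ, e, show 2 * (n + 1) + 2 = 2 * n + 4 by ring,
        show (n + 1) ^ 2 + 2 * (n + 1) = n ^ 2 + 2 * n + (2 * n + 3) by ring, pow_add q (n ^ 2 + 2 * n)]
      simp only [B]
      field_simp
  have hPA : ∀ n, (∏ i ∈ Finset.range n, B i) * A n = (1 + q ^ 2) / q * (q ^ ((n + 1) ^ 2) /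
      (qPoch (-q) (q ^ 2) (n + 1) * (1 + q ^ (2 * (n + 1))))) := by
    intro n
    have e : 1 - (q ^ 2) ^ n * -q = 1 + q ^ (2 * n + 1) := by ring
    rw [hP, qPoch_succ, e, show 2 * (n + 1) = 2 * n + 2 by ring,
      show (n + 1) ^ 2 = n ^ 2 + 2 * n + 1 by ring, pow_succ q (n ^ 2 + 2 * n)]
    simp only [A]
    field_simp
  have hrec : ∀ k, f k = A k + B k * f (k + 1) := by
    intro k
    have n1 := one_add_pow_ne_zero hq (k := 2 * k + 1) (by omega)
    have n2 := one_add_pow_ne_zero hq (k := 2 * k + 4) (by omega)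
    have h := one_sub_mul_fineSum hq hb (hc k) (hz k)
    rw [show q ^ 2 * -q ^ (2 * k + 4) = -q ^ (2 * (k + 1) + 4) by ring,
      show q ^ 2 * -q ^ (2 * k + 1) = -q ^ (2 * (k + 1) + 1) by ring] at h
    simp only [f, A, B]
    rw [sub_neg_eq_add, sub_neg_eq_add] at h
    rw [← mul_right_inj' n1, h]
    field_simp
    ring
  have hs : Summable fun k => (∏ i ∈ Finset.range k, B i) * A k := by
    simp_rw [hPA]
    exact (summable_sq_series hq).mul_left _
  have hB : Filter.Tendsto (fun n => ∏ i ∈ Finset.range n, B i) Filter.atTop (nhds 0) := by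
    simp_rw [hP]
    have : Summable fun n : ℕ =>
        q ^ (n ^ 2 + 2 * n) / (qPoch (-q) (q ^ 2) n * (1 + q ^ (2 * n + 2))) :=
      .of_norm_bounded (summable_prodBound_mul_pow hq _) fun n =>
        norm_pow_div_le (m := n) hq (by omega) (by nlinarith)
    simpa using this.tendsto_atTop_zero.const_mul (1 + q ^ 2)
  have main := tsum_iterate_eq (fun k => norm_fineSum_le hq hb (hc k) (hz k)) hrec hB hs
  simp_rw [hPA, tsum_mul_left] at main
  simp only [mul_zero, zero_add, pow_one] at main
  rw [← main]
  field_simp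

lemma norm_alternating_term_le {q : ℂ} (hq : ‖q‖ < 1) (n : ℕ) :
    ‖(-1) ^ n * q ^ (n + 1) * qPoch (q ^ 2) (q ^ 2) n / qPoch (-q ^ 2) (q ^ 2) (n + 1)‖ ≤
      prodBound ‖q‖ ^ 2 * ‖q‖ ^ n := by
  have hb : ‖q ^ 2‖ ≤ ‖q‖ := by simpa [pow_succ] using norm_pow_mul_le hq le_rfl 1
  rw [mul_div_assoc, norm_mul, norm_mul, norm_pow, norm_pow, norm_neg, norm_one, one_pow, one_mul,
    mul_comm]
  exact mul_le_mul (norm_qPoch_div_le hq hb (norm_neg_pow_le hq (by omega)) n (n + 1))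
    (pow_le_pow_of_le_one (norm_nonneg _) hq.le (by omega)) (by positivity) (by positivity)

lemma summable_alternating_series {q : ℂ} (hq : ‖q‖ < 1) : Summable fun n : ℕ =>
    (-1) ^ n * q ^ (n + 1) * qPoch (q ^ 2) (q ^ 2) n / qPoch (-q ^ 2) (q ^ 2) (n + 1) :=
  .of_norm_bounded (summable_prodBound_mul_pow hq _) (norm_alternating_term_le hq)

lemma tsum_alternating_series {q : ℂ} : ∑' n : ℕ,
    (-1) ^ n * q ^ (n + 1) * qPoch (q ^ 2) (q ^ 2) n / qPoch (-q ^ 2) (q ^ 2) (n + 1) =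
      q / (1 + q ^ 2) * fineSum q (q ^ 2) (-q ^ 4) (-q) := by
  rw [fineSum, ← tsum_mul_left]
  refine tsum_congr fun n => ?_
  rw [qPoch_succ', show q ^ 2 * -q ^ 2 = -q ^ 4 by ring, sub_neg_eq_add, neg_pow q n, pow_succ q n]
  simp only [div_eq_mul_inv, mul_inv]
  ring

/-! ### A third series for the same value. -/

lemma norm_third_term_le {q : ℂ} (hq : ‖q‖ < 1) (k n m : ℕ) (hn : n ≤ m) :
    ‖(-1) ^ k * q ^ m * (qPoch q (q ^ 2) k / qPoch (-q) (q ^ 2) (k + 1))‖ ≤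
      prodBound ‖q‖ ^ 2 * ‖q‖ ^ n := by
  rw [norm_mul, norm_mul, norm_pow, norm_pow, norm_neg, norm_one, one_pow, one_mul, mul_comm]
  exact mul_le_mul (norm_qPoch_div_le hq le_rfl (by rw [norm_neg]) _ _)
    (pow_le_pow_of_le_one (norm_nonneg _) hq.le hn) (by positivity) (by positivity)

/-- Here c = -q⁴ stays fixed while z runs through -q, -q³, -q⁵, …, so `one_sub_mul_fineSum_self` can
be iterated. -/
lemma mul_fineSum_eq_tsum {q : ℂ} (hq : ‖q‖ < 1) :
    q / (1 + q ^ 2) * fineSum q (q ^ 2) (-q ^ 4) (-q) =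
      ∑' k : ℕ, (-1) ^ k * q ^ (2 * k + 1) *
        (qPoch q (q ^ 2) k / qPoch (-q) (q ^ 2) (k + 1)) := by
  have h2 := one_add_pow_ne_zero hq (k := 2) (by omega)
  have hb : ‖q ^ 2‖ ≤ ‖q‖ := by simpa [pow_succ] using norm_pow_mul_le hq le_rfl 1
  have hc : ‖-q ^ 4‖ ≤ ‖q‖ := norm_neg_pow_le hq (by omega)
  have hz : ∀ k : ℕ, ‖-q ^ (2 * k + 1)‖ ≤ ‖q‖ := fun k => norm_neg_pow_le hq (by omega)
  have hP : ∀ n, ∏ i ∈ Finset.range n, (-q ^ 2 * (1 - q ^ (2 * i + 1)) / (1 + q ^ (2 * i + 1))) =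
      (-1) ^ n * q ^ (2 * n) * (qPoch q (q ^ 2) n / qPoch (-q) (q ^ 2) n) := by
    intro n
    induction n with
    | zero => simp [qPoch_zero]
    | succ n ih =>
      rw [Finset.prod_range_succ, ih, qPoch_succ, qPoch_succ, mul_neg, sub_neg_eq_add, ← pow_mul,
        ← pow_succ]
      simp only [div_eq_mul_inv, mul_inv]
      ring
  have hPA : ∀ n, (∏ i ∈ Finset.range n,
      (-q ^ 2 * (1 - q ^ (2 * i + 1)) / (1 + q ^ (2 * i + 1)))) *
        ((1 + q ^ 2) / (1 + q ^ (2 * n + 1))) = (1 + q ^ 2) * ((-1) ^ n * q ^ (2 * n) *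
          (qPoch q (q ^ 2) n / qPoch (-q) (q ^ 2) (n + 1))) := by
    intro n
    rw [hP, qPoch_succ (-q), mul_neg, sub_neg_eq_add, ← pow_mul, ← pow_succ]
    simp only [div_eq_mul_inv, mul_inv]
    ring
  have hrec : ∀ k, fineSum q (q ^ 2) (-q ^ 4) (-q ^ (2 * k + 1)) =
      (1 + q ^ 2) / (1 + q ^ (2 * k + 1)) +
      (-q ^ 2 * (1 - q ^ (2 * k + 1)) / (1 + q ^ (2 * k + 1))) *
        fineSum q (q ^ 2) (-q ^ 4) (-q ^ (2 * (k + 1) + 1)) := by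
    intro k
    have n1 := one_add_pow_ne_zero hq (k := 2 * k + 1) (by omega)
    have h := one_sub_mul_fineSum_self hq (hz k)
    rw [show q ^ 2 * -q ^ (2 * k + 1) = -q ^ (2 * (k + 1) + 1) by ring, sub_neg_eq_add] at h
    rw [← mul_right_inj' n1, h]
    field_simp
    ring
  have hs : Summable fun k : ℕ => (-1) ^ k * q ^ (2 * k) *
        (qPoch q (q ^ 2) k / qPoch (-q) (q ^ 2) (k + 1)) :=
    .of_norm_bounded (summable_prodBound_mul_pow hq _)
      fun k => norm_third_term_le hq k k (2 * k) (by omega)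
  have hB : Filter.Tendsto (fun n => ∏ i ∈ Finset.range n,
      (-q ^ 2 * (1 - q ^ (2 * i + 1)) / (1 + q ^ (2 * i + 1)))) Filter.atTop (nhds 0) := by
    refine squeeze_zero_norm (a := fun n => prodBound ‖q‖ ^ 2 * ‖q‖ ^ n) (fun n => ?_)
      (summable_prodBound_mul_pow hq _).tendsto_atTop_zero
    rw [hP, norm_mul, norm_mul, norm_pow, norm_pow, norm_neg, norm_one, one_pow, one_mul, mul_comm]
    exact mul_le_mul (norm_qPoch_div_le hq le_rfl (by rw [norm_neg]) _ _)
      (pow_le_pow_of_le_one (norm_nonneg _) hq.le (by omega)) (by positivity) (by positivity)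
  have main := tsum_iterate_eq (fun k => norm_fineSum_le hq hb hc (hz k)) hrec hB
    (by simp_rw [hPA]; exact hs.mul_left _)
  simp_rw [hPA] at main
  simp only [tsum_mul_left, mul_zero, zero_add, pow_one] at main
  rw [← main, ← mul_assoc, div_mul_cancel₀ _ h2, ← tsum_mul_left]
  exact tsum_congr fun k => by ring

/-! ### The kernel of the Bailey-type expansion and its Abel sums. -/

/-- The reciprocal `1 / (q²; q²)_k`, extended by `0` to negative integers `k`. -/
noncomputable def invQFact (q : ℂ) (k : ℤ) : ℂ :=
  if 0 ≤ k then (qPoch (q ^ 2) (q ^ 2) k.toNat)⁻¹ else 0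

lemma norm_sq_le {q : ℂ} (hq : ‖q‖ < 1) : ‖q ^ 2‖ ≤ ‖q‖ := by
  simpa [pow_succ] using norm_pow_mul_le hq le_rfl 1

lemma invQFact_natCast (q : ℂ) (n : ℕ) : invQFact q n = (qPoch (q ^ 2) (q ^ 2) n)⁻¹ := by
  simp [invQFact]

lemma invQFact_of_neg {q : ℂ} {k : ℤ} (hk : k < 0) : invQFact q k = 0 := by
  simp [invQFact, hk]

lemma norm_invQFact_le {q : ℂ} (hq : ‖q‖ < 1) (k : ℤ) : ‖invQFact q k‖ ≤ prodBound ‖q‖ := by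
  unfold invQFact
  split_ifs
  · exact norm_inv_qPoch_le hq (norm_sq_le hq) _
  · simpa using (prodBound_pos _).le

/-- Extension by zero is what makes this hold for every integer: at k = 0 the factor 1 - (q²)^0
vanishes. Later kernel identities therefore need no case split at the edge of the support. -/
lemma invQFact_sub_one {q : ℂ} (hq : ‖q‖ < 1) (k : ℤ) :
    invQFact q (k - 1) = (1 - (q ^ 2) ^ k) * invQFact q k := by
  rcases lt_trichotomy k 0 with h | rfl | h
  · rw [invQFact_of_neg h, invQFact_of_neg (by omega), mul_zero]
  · simp [invQFact_of_neg]
  · obtain ⟨n, rfl⟩ : ∃ n : ℕ, k = (n : ℤ) + 1 := ⟨(k - 1).toNat, by omega⟩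
    have h1 := qPoch_succ (q ^ 2) (q ^ 2) n
    have n2 := qPoch_ne_zero hq (norm_sq_le hq) (n + 1)
    have n3 : 1 - (q ^ 2) ^ n * q ^ 2 ≠ 0 := fun h => n2 (by rw [h1, h, mul_zero])
    rw [add_sub_cancel_right, invQFact_natCast, show ((n : ℤ) + 1) = ((n + 1 : ℕ) : ℤ) by simp,
      invQFact_natCast, h1, zpow_natCast, pow_succ (q ^ 2), mul_inv, mul_left_comm, mul_inv_cancel₀ n3,
      mul_one]

/-- `(q⁴; q⁴)_n / ((q²; q²)_{n - a} (q²; q²)_{n + a})`. -/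
noncomputable def conjTerm (q : ℂ) (a : ℤ) (n : ℕ) : ℂ :=
  qPoch (q ^ 2) (q ^ 2) n * qPoch (-q ^ 2) (q ^ 2) n * (invQFact q (n - a) * invQFact q (n + a))

/-- `(q⁴; q⁴)_n / ((q²; q²)_{n - a} (q²; q²)_{n + a + 1})`. -/
noncomputable def conjTermOdd (q : ℂ) (a : ℤ) (n : ℕ) : ℂ :=
  qPoch (q ^ 2) (q ^ 2) n * qPoch (-q ^ 2) (q ^ 2) n *
    (invQFact q (n - a) * invQFact q (n + a + 1))

lemma conjTerm_neg (q : ℂ) (a : ℤ) (n : ℕ) : conjTerm q (-a) n = conjTerm q a n := by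
  rw [conjTerm, conjTerm, sub_neg_eq_add, ← sub_eq_add_neg, mul_comm (invQFact q _)]

/-- Over the common denominator of `conjTermOdd`, with Q = q², the left side is (1 - Q^{n+a+1}) -
Q^{2a+1}(1 - Q^{n-a}), where the powers depending on n cancel. -/
lemma conjTerm_sub {q : ℂ} (h0 : q ≠ 0) (hq : ‖q‖ < 1) (a : ℤ) (n : ℕ) :
    conjTerm q a n - (q ^ 2) ^ (2 * a + 1) * conjTerm q (a + 1) n =
      (1 - (q ^ 2) ^ (2 * a + 1)) * conjTermOdd q a n := by
  have h1 := invQFact_sub_one hq (n - a)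
  have h2 := invQFact_sub_one hq (n + a + 1)
  have h3 : (q ^ 2) ^ (2 * a + 1) * (q ^ 2) ^ (n - a) = (q ^ 2) ^ (n + a + 1) := by
    rw [← zpow_add₀ (pow_ne_zero 2 h0)]; congr 1; ring
  rw [add_sub_cancel_right] at h2
  rw [conjTerm, conjTerm, conjTermOdd, h2, ← sub_sub, h1, ← add_assoc]
  linear_combination qPoch (q ^ 2) (q ^ 2) n * qPoch (-q ^ 2) (q ^ 2) n *
    (invQFact q (n - a) * invQFact q (n + a + 1)) * h3

lemma numerator_succ (q : ℂ) (n : ℕ) :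
    qPoch (q ^ 2) (q ^ 2) (n + 1) * qPoch (-q ^ 2) (q ^ 2) (n + 1) =
      qPoch (q ^ 2) (q ^ 2) n * qPoch (-q ^ 2) (q ^ 2) n * (1 - q ^ (4 * n + 4)) := by
  rw [qPoch_succ, qPoch_succ]; ring

lemma sq_zpow_mul {q : ℂ} (h0 : q ≠ 0) (a : ℤ) (n : ℕ) :
    (q ^ 2) ^ ((n : ℤ) + 1 - a) * (q ^ 2) ^ ((n : ℤ) + 1 + a) = q ^ (4 * n + 4) := by
  rw [← zpow_add₀ (pow_ne_zero 2 h0), show (n : ℤ) + 1 - a + (n + 1 + a) = ((2 * n + 2 : ℕ) : ℤ) by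
    push_cast; ring, zpow_natCast, ← pow_mul]
  congr 1; ring

/-- With u = (q²)^{n+1-a} and v = (q²)^{n+1+a}, so that uv = q^{4n+4}, this is (1-u) + (1-v) =
(1-u)(1-v) + (1-uv). -/
lemma conjTermOdd_add {q : ℂ} (h0 : q ≠ 0) (hq : ‖q‖ < 1) (a : ℤ) (n : ℕ) :
    conjTermOdd q a n + conjTermOdd q (a - 1) n = conjTerm q a n + conjTerm q a (n + 1) := by
  have h1 := invQFact_sub_one hq (n + 1 - a)
  have h2 := invQFact_sub_one hq (n + 1 + a)
  have h3 := sq_zpow_mul h0 a n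
  rw [show (n : ℤ) + 1 - a - 1 = n - a by ring] at h1
  rw [show (n : ℤ) + 1 + a - 1 = n + a by ring] at h2
  rw [conjTerm, conjTerm, conjTermOdd, conjTermOdd, numerator_succ, ← h3,
    show (n : ℤ) + a + 1 = n + 1 + a by ring, show (n : ℤ) - (a - 1) = n + 1 - a by ring,
    show (n : ℤ) + (a - 1) + 1 = n + a by ring, Nat.cast_succ, h1, h2]
  ring

/-- In the same u, v: (1-u)(1-v) - (1-uv) = 2uv - u - v. This is small for large n, whereas
`conjTerm` itself does not tend to zero; hence the use of differences and Abel sums. -/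
lemma conjTerm_sub_succ {q : ℂ} (h0 : q ≠ 0) (hq : ‖q‖ < 1) (a : ℤ) (n : ℕ) :
    conjTerm q a n - conjTerm q a (n + 1) = qPoch (q ^ 2) (q ^ 2) n * qPoch (-q ^ 2) (q ^ 2) n *
      (invQFact q (n + 1 - a) * invQFact q (n + 1 + a)) *
        (2 * q ^ (4 * n + 4) - (q ^ 2) ^ ((n : ℤ) + 1 - a) - (q ^ 2) ^ ((n : ℤ) + 1 + a)) := by
  have h1 := invQFact_sub_one hq (n + 1 - a)
  have h2 := invQFact_sub_one hq (n + 1 + a)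
  rw [show (n : ℤ) + 1 - a - 1 = n - a by ring] at h1
  rw [show (n : ℤ) + 1 + a - 1 = n + a by ring] at h2
  rw [conjTerm, conjTerm, numerator_succ, ← sq_zpow_mul h0 a n, Nat.cast_succ, h1, h2]
  ring

/-- The weight q^{a²} gives joint decay in a and n, needed both to exchange the two sums and to
bound `conjSum` uniformly in a. The 4 counts the monomials of 2uv - u - v, and the fourth power
counts the four Pochhammer factors. -/
lemma norm_pow_mul_conjTerm_sub_le {q : ℂ} (h0 : q ≠ 0) (hq : ‖q‖ < 1) (a n : ℕ) :
    ‖q ^ (a ^ 2) * (conjTerm q a n - conjTerm q a (n + 1))‖ ≤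
      4 * prodBound ‖q‖ ^ 4 * (‖q‖ ^ a * ‖q‖ ^ n) := by
  have hK := prodBound_pos ‖q‖
  have hρ : 0 ≤ ‖q‖ := norm_nonneg q
  rw [conjTerm_sub_succ h0 hq]
  rcases lt_or_ge (n + 1) a with h | h
  · rw [invQFact_of_neg (k := (n : ℤ) + 1 - a) (by omega)]
    simp only [zero_mul, mul_zero, norm_zero]
    positivity
  obtain ⟨d, hd⟩ := Nat.exists_eq_add_of_le h
  have e1 : (n : ℤ) + 1 - a = (d : ℕ) := by omega
  have e2 : (n : ℤ) + 1 + a = ((d + 2 * a : ℕ) : ℤ) := by push_cast; omega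
  -- With n + 1 = a + d, the required a + n ≤ a² + 2d reduces to 2a ≤ a² + 1.
  have bd : ∀ j : ℕ, 2 * d ≤ j → ‖q ^ (a ^ 2) * q ^ j‖ ≤ ‖q‖ ^ a * ‖q‖ ^ n := fun j hj => by
    rw [norm_mul, norm_pow, norm_pow, ← pow_add, ← pow_add]
    refine pow_le_pow_of_le_one hρ hq.le ?_
    have : 2 * a ≤ a ^ 2 + 1 := by nlinarith [sq_nonneg ((a : ℤ) - 1)]
    omega
  have h4 : ‖q ^ (a ^ 2) * (2 * q ^ (4 * n + 4) - (q ^ 2) ^ ((n : ℤ) + 1 - a)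
      - (q ^ 2) ^ ((n : ℤ) + 1 + a))‖ ≤ 4 * (‖q‖ ^ a * ‖q‖ ^ n) := by
    rw [e1, e2, zpow_natCast, zpow_natCast, ← pow_mul, ← pow_mul]
    have b1 := bd (4 * n + 4) (by omega)
    have b2 := bd (2 * d) le_rfl
    have b3 := bd (2 * (d + 2 * a)) (by omega)
    calc _ = ‖q ^ (a ^ 2) * q ^ (4 * n + 4) + q ^ (a ^ 2) * q ^ (4 * n + 4)
          - q ^ (a ^ 2) * q ^ (2 * d) - q ^ (a ^ 2) * q ^ (2 * (d + 2 * a))‖ := by congr 1; ring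
      _ ≤ _ := by
        have := norm_sub_le (q ^ (a ^ 2) * q ^ (4 * n + 4) + q ^ (a ^ 2) * q ^ (4 * n + 4)
          - q ^ (a ^ 2) * q ^ (2 * d)) (q ^ (a ^ 2) * q ^ (2 * (d + 2 * a)))
        have := norm_sub_le (q ^ (a ^ 2) * q ^ (4 * n + 4) + q ^ (a ^ 2) * q ^ (4 * n + 4))
          (q ^ (a ^ 2) * q ^ (2 * d))
        have := norm_add_le (q ^ (a ^ 2) * q ^ (4 * n + 4)) (q ^ (a ^ 2) * q ^ (4 * n + 4))
        linarith
  have h5 : ‖qPoch (q ^ 2) (q ^ 2) n * qPoch (-q ^ 2) (q ^ 2) n *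
      (invQFact q (n + 1 - a) * invQFact q (n + 1 + a))‖ ≤ prodBound ‖q‖ ^ 4 := by
    have b1 := norm_qPoch_le hq (norm_sq_le hq) n
    have b2 := norm_qPoch_le hq (norm_neg_pow_le hq (k := 2) (by omega)) n
    have b3 := norm_invQFact_le hq (n + 1 - a)
    have b4 := norm_invQFact_le hq (n + 1 + a)
    rw [norm_mul, norm_mul, norm_mul, show prodBound ‖q‖ ^ 4 = (prodBound ‖q‖ * prodBound ‖q‖) *
      (prodBound ‖q‖ * prodBound ‖q‖) by ring]
    gcongr
  rw [mul_left_comm, norm_mul]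
  calc _ ≤ prodBound ‖q‖ ^ 4 * (4 * (‖q‖ ^ a * ‖q‖ ^ n)) :=
        mul_le_mul h5 h4 (norm_nonneg _) (by positivity)
    _ = _ := by ring

/-- `s` is the Abel sum of the alternating series `∑ (-1)^n x n`. -/
def HasAltSum (x : ℕ → ℂ) (s : ℂ) : Prop :=
  HasSum (fun n => (-1) ^ n * (x n - x (n + 1))) (2 * s - x 0)

namespace HasAltSum

variable {x y : ℕ → ℂ} {s t : ℂ}

lemma congr (h : HasAltSum x s) (hxy : ∀ n, x n = y n) : HasAltSum y s := by
  rwa [show y = x from funext fun n => (hxy n).symm]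

lemma unique (h : HasAltSum x s) (h' : HasAltSum x t) : s = t := by
  linear_combination (HasSum.unique h h') / 2

lemma const_mul (h : HasAltSum x s) (c : ℂ) : HasAltSum (fun n => c * x n) (c * s) := by
  have := HasSum.mul_left c h
  rw [mul_sub, mul_left_comm] at this
  refine (congrArg (fun f : ℕ → ℂ => HasSum f _) (funext fun n => ?_)).mpr this
  ring

lemma sub (h : HasAltSum x s) (h' : HasAltSum y t) : HasAltSum (fun n => x n - y n) (s - t) := by
  have := HasSum.sub h h'
  rw [show 2 * s - x 0 - (2 * t - y 0) = 2 * (s - t) - (x 0 - y 0) by ring] at this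
  refine (congrArg (fun f : ℕ → ℂ => HasSum f _) (funext fun n => ?_)).mpr this
  ring

/-- Formally ∑ (-1)^n (x_n + x_{n+1}) telescopes to x_0. In terms of t_n = (-1)^n (x_n - x_{n+1}),
the defining series is ∑ (t_n - t_{n+1}) = t_0. -/
lemma add_shift (h : HasAltSum x s) : HasAltSum (fun n => x n + x (n + 1)) (x 0) := by
  have h1 : Summable fun n => (-1) ^ n * (x n - x (n + 1)) := HasSum.summable h
  have h2 := h1.hasSum.sub ((summable_nat_add_iff 1).2 h1).hasSum
  have h3 := h1.sum_add_tsum_nat_add 1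
  rw [← h3, add_sub_cancel_right, Finset.sum_range_one, pow_zero, one_mul,
    show x 0 - x (0 + 1) = 2 * x 0 - (x 0 + x (0 + 1)) by ring] at h2
  refine (congrArg (fun f : ℕ → ℂ => HasSum f _) (funext fun n => ?_)).mpr h2
  ring

end HasAltSum

lemma conjTerm_zero_right (q : ℂ) (a : ℤ) : conjTerm q a 0 = if a = 0 then 1 else 0 := by
  split_ifs with h
  · subst h
    simp [conjTerm, qPoch_zero, invQFact]
  · rcases lt_or_gt_of_ne h with h | h
    · rw [conjTerm, invQFact_of_neg (k := ((0 : ℕ) : ℤ) + a) (by simpa using h)]; simp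
    · rw [conjTerm, invQFact_of_neg (k := ((0 : ℕ) : ℤ) - a) (by simpa using h)]; simp

lemma summable_pow_mul_conjTerm_sub {q : ℂ} (h0 : q ≠ 0) (hq : ‖q‖ < 1) (a : ℕ) :
    Summable fun n => (-1) ^ n * (q ^ (a ^ 2) * (conjTerm q a n - conjTerm q a (n + 1))) := by
  refine .of_norm_bounded ((summable_prodBound_mul_pow hq (‖q‖ ^ a)).mul_left
    (4 * prodBound ‖q‖ ^ 4)) fun n => ?_
  simpa using norm_pow_mul_conjTerm_sub_le h0 hq a n

/-- The Abel sum of `∑ (-1)^n conjTerm q a n`. -/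
noncomputable def conjSum (q : ℂ) (a : ℕ) : ℂ :=
  (conjTerm q a 0 + ∑' n : ℕ, (-1) ^ n * (conjTerm q a n - conjTerm q a (n + 1))) / 2

lemma hasAltSum_conjTerm {q : ℂ} (h0 : q ≠ 0) (hq : ‖q‖ < 1) (a : ℕ) :
    HasAltSum (conjTerm q a) (conjSum q a) := by
  have h1 := (summable_pow_mul_conjTerm_sub h0 hq a).mul_left (q ^ (a ^ 2))⁻¹
  have h2 : Summable fun n => (-1) ^ n * (conjTerm q a n - conjTerm q a (n + 1)) :=
    h1.congr fun n => by
      rw [mul_left_comm, inv_mul_cancel_left₀ (pow_ne_zero _ h0)]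
  have h3 := h2.hasSum
  unfold HasAltSum
  rwa [conjSum, mul_div_cancel₀ _ two_ne_zero, add_sub_cancel_left]

lemma norm_pow_mul_conjSum_le {q : ℂ} (h0 : q ≠ 0) (hq : ‖q‖ < 1) (a : ℕ) :
    ‖q ^ (a ^ 2) * conjSum q a‖ ≤
      1 + ∑' n : ℕ, 4 * prodBound ‖q‖ ^ 4 * ‖q‖ ^ n := by
  have h1 : q ^ (a ^ 2) * conjSum q a = (q ^ (a ^ 2) * conjTerm q a 0 + ∑' n : ℕ,
      (-1) ^ n * (q ^ (a ^ 2) * (conjTerm q a n - conjTerm q a (n + 1)))) / 2 := by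
    simp_rw [conjSum, mul_left_comm _ (q ^ (a ^ 2)), tsum_mul_left]
    ring
  have h2 : ‖q ^ (a ^ 2) * conjTerm q a 0‖ ≤ 1 := by
    rw [conjTerm_zero_right, norm_mul, norm_pow]
    have h : ‖q‖ ^ (a ^ 2) ≤ 1 := pow_le_one₀ (norm_nonneg _) hq.le
    split_ifs <;> simp [h]
  have h3 : ‖∑' n : ℕ, (-1) ^ n * (q ^ (a ^ 2) * (conjTerm q a n - conjTerm q a (n + 1)))‖ ≤
      ∑' n : ℕ, 4 * prodBound ‖q‖ ^ 4 * ‖q‖ ^ n := by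
    refine tsum_of_norm_bounded (summable_prodBound_mul_pow hq _).hasSum fun n => ?_
    have h4 := norm_pow_mul_conjTerm_sub_le h0 hq a n
    rw [norm_mul, norm_pow, norm_neg, norm_one, one_pow, one_mul]
    refine h4.trans (mul_le_mul_of_nonneg_left ?_ (by have := prodBound_pos ‖q‖; positivity))
    exact mul_le_of_le_one_left (by positivity) (pow_le_one₀ (norm_nonneg _) hq.le)
  rw [h1, norm_div, Complex.norm_two]
  have h4 := norm_add_le (q ^ (a ^ 2) * conjTerm q a 0)
    (∑' n : ℕ, (-1) ^ n * (q ^ (a ^ 2) * (conjTerm q a n - conjTerm q a (n + 1))))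
  rw [div_le_iff₀ two_pos]
  have h5 := norm_nonneg (q ^ (a ^ 2) * conjTerm q a 0 +
    ∑' n : ℕ, (-1) ^ n * (q ^ (a ^ 2) * (conjTerm q a n - conjTerm q a (n + 1))))
  linarith

/-- By `conjTermOdd_add` and `add_shift`, the sums at a and a - 1 add up to `conjTerm q a 0`, which
is 1 for a = 0 and 0 otherwise. So the sign alternates with a, and only the starting value 1/2 has
to be found. -/
lemma hasAltSum_conjTermOdd {q : ℂ} (h0 : q ≠ 0) (hq : ‖q‖ < 1) (a : ℕ) :
    HasAltSum (conjTermOdd q a) ((-1) ^ a / 2) := by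
  induction a with
  | zero =>
    have h := (hasAltSum_conjTerm h0 hq 0).add_shift.const_mul (1 / 2)
    rw [conjTerm_zero_right, if_pos (by simp), mul_one] at h
    rw [pow_zero]
    refine h.congr fun n => ?_
    have h1 := conjTermOdd_add h0 hq 0 n
    -- The reflection a ↦ -1 - a swaps the two reciprocal factors, so the indices -1 and 0
    -- contribute equally.
    have h2 : conjTermOdd q (0 - 1) n = conjTermOdd q 0 n := by
      rw [conjTermOdd, conjTermOdd, show (n : ℤ) - (0 - 1) = n + 0 + 1 by ring,
        show (n : ℤ) + (0 - 1) + 1 = n - 0 by ring, mul_comm (invQFact q _)]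
    rw [h2] at h1
    push_cast
    rw [← h1]
    ring
  | succ a ih =>
    have h := (hasAltSum_conjTerm h0 hq (a + 1)).add_shift.sub ih
    rw [conjTerm_zero_right, if_neg (by omega),
      show 0 - (-1 : ℂ) ^ a / 2 = (-1) ^ (a + 1) / 2 by ring] at h
    refine h.congr fun n => ?_
    have h1 := conjTermOdd_add h0 hq (a + 1 : ℕ) n
    rw [← h1]
    push_cast
    rw [add_sub_cancel_right (a : ℤ) 1]
    ring

lemma conjSum_sub {q : ℂ} (h0 : q ≠ 0) (hq : ‖q‖ < 1) (a : ℕ) :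
    conjSum q a - q ^ (4 * a + 2) * conjSum q (a + 1) =
      (1 - q ^ (4 * a + 2)) * ((-1) ^ a / 2) := by
  have h1 := (hasAltSum_conjTerm h0 hq a).sub
    ((hasAltSum_conjTerm h0 hq (a + 1)).const_mul (q ^ (4 * a + 2)))
  have h2 := (hasAltSum_conjTermOdd h0 hq a).const_mul (1 - q ^ (4 * a + 2))
  refine h1.unique (h2.congr fun n => ?_)
  have h3 := conjTerm_sub h0 hq a n
  rw [show (2 * (a : ℤ) + 1) = ((2 * a + 1 : ℕ) : ℤ) by push_cast; ring, zpow_natCast, ← pow_mul,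
    show 2 * (2 * a + 1) = 4 * a + 2 by ring] at h3
  rw [← h3]
  push_cast
  rfl

/-- The term `(-1)^b q^{n² - 2 b²}` with `n = a + 2 b`. -/
noncomputable def coneTerm (q : ℂ) (a b : ℕ) : ℂ := (-1) ^ b * q ^ (a ^ 2 + 4 * a * b + 2 * b ^ 2)

lemma norm_coneTerm_le {q : ℂ} (hq : ‖q‖ < 1) (a b : ℕ) :
    ‖coneTerm q a b‖ ≤ ‖q‖ ^ a * ‖q‖ ^ b := by
  rw [coneTerm, norm_mul, norm_pow, norm_pow, norm_neg, norm_one, one_pow, one_mul, ← pow_add]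
  refine pow_le_pow_of_le_one (norm_nonneg _) hq.le ?_
  nlinarith [Nat.le_self_pow (n := 2) (by norm_num) a, Nat.le_self_pow (n := 2) (by norm_num) b]

lemma summable_coneTerm {q : ℂ} (hq : ‖q‖ < 1) (a : ℕ) : Summable (coneTerm q a) :=
  .of_norm_bounded (summable_prodBound_mul_pow hq _) (norm_coneTerm_le hq a)

/-- Stepping b by one equals stepping a by one: `coneTerm q a (b + 1)` is -q^{2a+1} times `coneTerm
q (a + 1) b`. -/
lemma tsum_coneTerm_rec {q : ℂ} (hq : ‖q‖ < 1) (a : ℕ) :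
    ∑' b, coneTerm q a b = q ^ (a ^ 2) - q ^ (2 * a + 1) * ∑' b, coneTerm q (a + 1) b := by
  rw [(summable_coneTerm hq a).tsum_eq_zero_add, ← tsum_mul_left, sub_eq_add_neg, ← tsum_neg]
  congr 1
  · simp [coneTerm]
  · refine tsum_congr fun b => ?_
    simp only [coneTerm]
    ring

/-- Both sides satisfy the same inhomogeneous recurrence in a, so their difference satisfies e_a =
-q^{2a+1} e_{a+1}. Being bounded uniformly in a, it must vanish. -/
lemma conjSum_eq {q : ℂ} (h0 : q ≠ 0) (hq : ‖q‖ < 1) (a : ℕ) :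
    (-1) ^ a * q ^ (a ^ 2) * conjSum q a = ∑' b, coneTerm q a b - q ^ (a ^ 2) / 2 := by
  let e : ℕ → ℂ := fun a =>
    (-1) ^ a * q ^ (a ^ 2) * conjSum q a - (∑' b, coneTerm q a b - q ^ (a ^ 2) / 2)
  have hrec : ∀ a, e a = -q ^ (2 * a + 1) * e (a + 1) := fun a => by
    have h1 := conjSum_sub h0 hq a
    have h2 := tsum_coneTerm_rec hq a
    have h3 : ((-1 : ℂ) ^ a) * (-1) ^ a = 1 := by rw [← mul_pow]; norm_num
    simp only [e]
    rw [h2, show (a + 1) ^ 2 = a ^ 2 + 2 * a + 1 by ring]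
    rw [sub_eq_iff_eq_add] at h1
    rw [h1]
    simp only [pow_add, pow_mul', pow_one] at *
    linear_combination (1 - (q ^ a) ^ 4 * q ^ 2) * q ^ a ^ 2 / 2 * h3
  let M : ℝ := (1 + ∑' n : ℕ, 4 * prodBound ‖q‖ ^ 4 * ‖q‖ ^ n) + (∑' n : ℕ, 1 * ‖q‖ ^ n + 1)
  have hbd : ∀ a, ‖e a‖ ≤ M := fun a => by
    refine (norm_sub_le _ _).trans (add_le_add ?_ ((norm_sub_le _ _).trans (add_le_add ?_ ?_)))
    · rw [mul_assoc, norm_mul, norm_pow, norm_neg, norm_one, one_pow, one_mul]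
      exact norm_pow_mul_conjSum_le h0 hq a
    · refine tsum_of_norm_bounded (summable_prodBound_mul_pow hq 1).hasSum fun b => ?_
      exact (norm_coneTerm_le hq a b).trans
        (mul_le_mul_of_nonneg_right (pow_le_one₀ (norm_nonneg _) hq.le) (by positivity))
    · rw [norm_div, norm_pow, Complex.norm_two]
      have : ‖q‖ ^ (a ^ 2) ≤ 1 := pow_le_one₀ (norm_nonneg _) hq.le
      linarith
  have hstep : ∀ k a, ‖e a‖ ≤ ‖q‖ ^ k * M := by
    intro k
    induction k with
    | zero => intro a; simpa using hbd a
    | succ k ih =>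
      intro a
      rw [hrec, norm_mul, norm_neg, norm_pow, pow_succ' _ k, mul_assoc]
      refine mul_le_mul ?_ (ih _) (norm_nonneg _) (norm_nonneg _)
      simpa using pow_le_pow_of_le_one (norm_nonneg q) hq.le (show 1 ≤ 2 * a + 1 by omega)
  have hlim : Filter.Tendsto (fun k => ‖q‖ ^ k * M) Filter.atTop (nhds 0) := by
    simpa using (tendsto_pow_atTop_nhds_zero_of_lt_one (norm_nonneg q) hq).mul_const M
  have h : ‖e a‖ ≤ 0 := ge_of_tendsto' hlim fun k => hstep k a
  exact sub_eq_zero.1 (norm_le_zero_iff.1 h)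

/-! ### The finite triple product and the cone expansion of the third series. -/

lemma HasSum.of_eq_of_eq {ι : Type*} {f g : ι → ℂ} {a b : ℂ} (h : HasSum f a)
    (hfg : ∀ i, g i = f i) (hab : b = a) : HasSum g b := by
  rw [hab, show g = f from funext hfg]
  exact h

/-- A finite form of the Jacobi triple product identity at `-1`. -/
lemma hasSum_finite_triple {q : ℂ} (h0 : q ≠ 0) (hq : ‖q‖ < 1) (M N : ℕ) :
    HasSum (fun k : ℤ => (-1) ^ k * q ^ (k ^ 2) * (invQFact q (M + k) * invQFact q (N - k)))
      (invQFact q (M + N) * (qPoch q (q ^ 2) M * qPoch q (q ^ 2) N)) := by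
  have step : ∀ M N : ℕ, HasSum (fun k : ℤ => (-1) ^ k * q ^ (k ^ 2) *
        (invQFact q (M + k) * invQFact q (N - k)))
        (invQFact q (M + N) * (qPoch q (q ^ 2) M * qPoch q (q ^ 2) N)) →
      HasSum (fun k : ℤ => (-1) ^ k * q ^ (k ^ 2) *
        (invQFact q (M + k) * invQFact q ((N + 1 : ℕ) - k)))
        (invQFact q (M + (N + 1 : ℕ)) * (qPoch q (q ^ 2) M * qPoch q (q ^ 2) (N + 1))) := by
    intro M N h
    have hne : 1 - (q ^ 2) ^ ((M : ℤ) + N + 1) ≠ 0 := by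
      rw [show (M : ℤ) + N + 1 = ((M + N + 1 : ℕ) : ℤ) by push_cast; ring, zpow_natCast, ← pow_mul]
      refine one_sub_ne_zero_of_norm_lt_one ?_
      rw [norm_pow]
      exact pow_lt_one₀ (norm_nonneg _) hq (by omega)
    -- A q-Pascal rule: 1 - (q²)^{M+N+1} times the summand for N + 1 is the summand for N at k minus
    -- q^{2N+1} times the one at k - 1.
    have h1 := ((Equiv.subRight (1 : ℤ)).hasSum_iff.2 h).mul_left (-q ^ (2 * N + 1))
    have h2 := (h.add h1).mul_left (1 - (q ^ 2) ^ ((M : ℤ) + N + 1))⁻¹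
    have h3 := invQFact_sub_one hq (M + N + 1)
    rw [add_sub_cancel_right] at h3
    refine h2.of_eq_of_eq (fun k => ?_) ?_
    · have e1 := invQFact_sub_one hq (M + k)
      have e2 := invQFact_sub_one hq (N + 1 - k)
      rw [show (N : ℤ) + 1 - k - 1 = N - k by ring] at e2
      have e3 : (q ^ 2) ^ ((M : ℤ) + N + 1) = (q ^ 2) ^ ((M : ℤ) + k) * (q ^ 2) ^ ((N : ℤ) + 1 - k) := by
        rw [← zpow_add₀ (pow_ne_zero 2 h0)]; congr 1; ring
      have e4 : q ^ (2 * N + 1) * q ^ ((k - 1) ^ 2) = (q ^ 2) ^ ((N : ℤ) + 1 - k) * q ^ (k ^ 2) := by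
        rw [← zpow_natCast q 2, ← zpow_mul, ← zpow_natCast, ← zpow_add₀ h0, ← zpow_add₀ h0]
        congr 1; push_cast; ring
      have e5 : (-1 : ℂ) ^ k = -(-1) ^ (k - 1) := by
        rw [zpow_sub_one₀ (by norm_num)]; norm_num
      rw [eq_inv_mul_iff_mul_eq₀ hne]
      simp only [Function.comp, Equiv.subRight_apply]
      rw [show (M : ℤ) + (k - 1) = M + k - 1 by ring, show (N : ℤ) - (k - 1) = N + 1 - k by ring,
        e1, e2, Nat.cast_succ, e3, e5]
      linear_combination (-1) ^ (k - 1) * (1 - (q ^ 2) ^ ((M : ℤ) + k)) * invQFact q (M + k) *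
        invQFact q (N + 1 - k) * e4
    · rw [eq_inv_mul_iff_mul_eq₀ hne, qPoch_succ, h3, Nat.cast_succ, ← add_assoc]
      ring
  -- The substitution k ↦ -k exchanges M and N, so raising N is enough to raise M too.
  have symm : ∀ M N : ℕ, HasSum (fun k : ℤ => (-1) ^ k * q ^ (k ^ 2) *
        (invQFact q (M + k) * invQFact q (N - k)))
        (invQFact q (M + N) * (qPoch q (q ^ 2) M * qPoch q (q ^ 2) N)) →
      HasSum (fun k : ℤ => (-1) ^ k * q ^ (k ^ 2) *
        (invQFact q (N + k) * invQFact q (M - k)))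
        (invQFact q (N + M) * (qPoch q (q ^ 2) N * qPoch q (q ^ 2) M)) := by
    intro M N h
    refine ((Equiv.neg ℤ).hasSum_iff.2 h).of_eq_of_eq (fun k => ?_) ?_
    · simp only [Function.comp, Equiv.neg_apply]
      rw [neg_sq, ← sub_eq_add_neg, sub_neg_eq_add, zpow_neg, ← inv_zpow, inv_neg_one]
      ring
    · rw [add_comm, mul_comm (qPoch _ _ N)]
  induction M with
  | zero =>
    induction N with
    | zero =>
      refine (hasSum_single (0 : ℤ) ?_).of_eq_of_eq (fun _ => rfl) ?_
      rotate_left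
      · simp [qPoch_zero, invQFact]
      · intro k hk
        rcases lt_or_gt_of_ne hk with h | h
        · rw [invQFact_of_neg (k := ((0 : ℕ) : ℤ) + k) (by simpa using h)]; simp
        · rw [invQFact_of_neg (k := ((0 : ℕ) : ℤ) - k) (by simpa using h)]; simp
    | succ N ih => exact step 0 N ih
  | succ M ih => exact symm _ _ (step _ _ (symm _ _ ih))

lemma qPoch_two_mul (q : ℂ) (n : ℕ) : qPoch (q ^ 2) (q ^ 2) (2 * n) =
    qPoch q (q ^ 2) n * qPoch (-q) (q ^ 2) n * (qPoch (q ^ 2) (q ^ 2) n *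
      qPoch (-q ^ 2) (q ^ 2) n) := by
  induction n with
  | zero => simp [qPoch_zero]
  | succ n ih =>
    rw [show 2 * (n + 1) = 2 * n + 1 + 1 by ring, qPoch_succ, qPoch_succ, ih, numerator_succ,
      qPoch_succ, qPoch_succ]
    ring

/-- The finite triple product at M = N = n; its denominator (q²;q²)_{2n} splits by `qPoch_two_mul`,
cancelling one factor (q;q²)_n and the numerator of `conjTerm`. -/
lemma hasSum_conjTerm {q : ℂ} (h0 : q ≠ 0) (hq : ‖q‖ < 1) (n : ℕ) :
    HasSum (fun a : ℤ => (-1) ^ a * q ^ (a ^ 2) * conjTerm q a n)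
      (qPoch q (q ^ 2) n / qPoch (-q) (q ^ 2) n) := by
  have h := (hasSum_finite_triple h0 hq n n).mul_left
    (qPoch (q ^ 2) (q ^ 2) n * qPoch (-q ^ 2) (q ^ 2) n)
  have n1 := qPoch_ne_zero hq le_rfl n
  have n2 : qPoch (-q) (q ^ 2) n ≠ 0 := qPoch_ne_zero hq (by rw [norm_neg]) n
  have n3 := qPoch_ne_zero hq (norm_sq_le hq) n
  have n4 := qPoch_ne_zero hq (norm_neg_pow_le hq (k := 2) (by omega)) n
  refine h.of_eq_of_eq (fun a => ?_) ?_
  · rw [conjTerm]; ring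
  · rw [show (n : ℤ) + n = ((2 * n : ℕ) : ℤ) by push_cast; ring, invQFact_natCast, qPoch_two_mul]
    field_simp

lemma third_term_eq {q : ℂ} (hq : ‖q‖ < 1) (k : ℕ) :
    2 * ((-1) ^ k * q ^ (2 * k + 1) * (qPoch q (q ^ 2) k / qPoch (-q) (q ^ 2) (k + 1))) =
      (-1) ^ k * (qPoch q (q ^ 2) k / qPoch (-q) (q ^ 2) k
        - qPoch q (q ^ 2) (k + 1) / qPoch (-q) (q ^ 2) (k + 1)) := by
  have n1 : qPoch (-q) (q ^ 2) k ≠ 0 := qPoch_ne_zero hq (by rw [norm_neg]) k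
  have n2 := one_add_pow_ne_zero hq (k := 2 * k + 1) (by omega)
  rw [qPoch_succ, qPoch_succ, mul_neg, sub_neg_eq_add, ← pow_mul, ← pow_succ]
  field_simp
  ring

lemma summable_pow_natAbs {r : ℝ} (h0 : 0 ≤ r) (h1 : r < 1) : Summable fun a : ℤ => r ^ a.natAbs := by
  refine Summable.of_nat_of_neg ?_ ?_ <;>
  simpa using summable_geometric_of_lt_one h0 h1

lemma zpow_sq_eq_natAbs (q : ℂ) (a : ℤ) : q ^ (a ^ 2) = q ^ (a.natAbs ^ 2) := by
  rw [← zpow_natCast]; push_cast; rw [sq_abs]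

lemma neg_one_zpow_eq_natAbs (a : ℤ) : (-1 : ℂ) ^ a = (-1) ^ a.natAbs := by
  rcases Int.natAbs_eq a with h | h
  · conv_lhs => rw [h, zpow_natCast]
  · conv_lhs => rw [h, zpow_neg, zpow_natCast, ← inv_pow, inv_neg_one]

lemma conjTerm_natAbs (q : ℂ) (a : ℤ) (n : ℕ) : conjTerm q (a.natAbs : ℤ) n = conjTerm q a n := by
  rcases Int.natAbs_eq a with h | h
  · rw [← h]
  · conv_rhs => rw [h, conjTerm_neg]

lemma summable_double_conjTerm {q : ℂ} (h0 : q ≠ 0) (hq : ‖q‖ < 1) :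
    Summable fun p : ℕ × ℤ => (-1) ^ p.1 * ((-1) ^ p.2 * q ^ (p.2 ^ 2) *
      (conjTerm q p.2 p.1 - conjTerm q p.2 (p.1 + 1))) := by
  have hs : Summable fun p : ℕ × ℤ => 4 * prodBound ‖q‖ ^ 4 * (‖q‖ ^ p.1 * ‖q‖ ^ p.2.natAbs) :=
    ((summable_geometric_of_lt_one (norm_nonneg q) hq).mul_of_nonneg
      (summable_pow_natAbs (norm_nonneg q) hq) (fun _ => by positivity)
      (fun _ => by positivity)).mul_left _
  refine .of_norm_bounded hs fun p => ?_
  obtain ⟨n, a⟩ := p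
  have h := norm_pow_mul_conjTerm_sub_le h0 hq a.natAbs n
  rw [conjTerm_natAbs, conjTerm_natAbs] at h
  simp only [zpow_sq_eq_natAbs]
  rw [mul_assoc, norm_mul, norm_mul, norm_pow, norm_zpow, norm_neg, norm_one, one_pow, one_zpow,
    one_mul, one_mul, mul_comm (‖q‖ ^ n)]
  exact h

/-- The third series is a sum over the cone `{(n, m) | 2 |m| ≤ n}`. -/
lemma two_mul_third_series {q : ℂ} (h0 : q ≠ 0) (hq : ‖q‖ < 1) :
    2 * ∑' k : ℕ, (-1) ^ k * q ^ (2 * k + 1) *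
        (qPoch q (q ^ 2) k / qPoch (-q) (q ^ 2) (k + 1)) =
      ∑' a : ℤ, (2 * ∑' b, coneTerm q a.natAbs b - q ^ (a.natAbs ^ 2) - if a = 0 then 1 else 0) := by
  have hs := summable_double_conjTerm h0 hq
  have h1 : ∀ n : ℕ, ∑' a : ℤ, (-1) ^ n * ((-1) ^ a * q ^ (a ^ 2) *
      (conjTerm q a n - conjTerm q a (n + 1))) =
      (-1) ^ n * (qPoch q (q ^ 2) n / qPoch (-q) (q ^ 2) n
        - qPoch q (q ^ 2) (n + 1) / qPoch (-q) (q ^ 2) (n + 1)) := fun n => by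
    rw [tsum_mul_left]
    congr 1
    have := ((hasSum_conjTerm h0 hq n).sub (hasSum_conjTerm h0 hq (n + 1))).tsum_eq
    rw [← this]
    exact tsum_congr fun a => by ring
  rw [← tsum_mul_left]
  simp_rw [third_term_eq hq, ← h1]
  -- Exchanging the sums leaves, for each a, the difference series defining the Abel sum, equal to 2
  -- `conjSum` minus the value at n = 0. That value is the source of the correction at a = 0.
  refine (Summable.tsum_comm (f := fun (n : ℕ) (a : ℤ) => (-1) ^ n * ((-1) ^ a * q ^ (a ^ 2) *
      (conjTerm q a n - conjTerm q a (n + 1)))) hs).symm.trans (tsum_congr fun a => ?_)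
  have h2 := hasAltSum_conjTerm h0 hq a.natAbs
  unfold HasAltSum at h2
  have h3 := (h2.mul_left ((-1) ^ a.natAbs * q ^ (a.natAbs ^ 2))).tsum_eq
  have h4 := conjSum_eq h0 hq a.natAbs
  simp only [conjTerm_natAbs] at h3
  rw [conjTerm_zero_right] at h3
  rw [zpow_sq_eq_natAbs, neg_one_zpow_eq_natAbs]
  refine (tsum_congr fun n => ?_).trans (h3.trans ?_)
  · ring
  · split_ifs with h
    · subst h
      simp at h4 ⊢
      linear_combination 2 * h4
    · linear_combination 2 * h4

/-! ### Infinite products and the theta function. -/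

lemma qPochInf_multipliable {p : ℂ} (hp : ‖p‖ < 1) (x : ℂ) :
    Multipliable fun i : ℕ => 1 - p ^ i * x := by
  have h : Summable fun i : ℕ => ‖-(p ^ i * x)‖ := by
    simp only [norm_neg, norm_mul, norm_pow]
    exact (summable_geometric_of_lt_one (norm_nonneg _) hp).mul_right _
  simpa only [sub_eq_add_neg] using multipliable_one_add_of_summable h

lemma tendsto_qPoch {p : ℂ} (hp : ‖p‖ < 1) (x : ℂ) :
    Filter.Tendsto (qPoch x p) Filter.atTop (nhds (qPochInf x p)) :=
  (qPochInf_multipliable hp x).hasProd.tendsto_prod_nat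

lemma norm_sq_lt_one {q : ℂ} (hq : ‖q‖ < 1) : ‖q ^ 2‖ < 1 := (norm_sq_le hq).trans_lt hq

lemma qPochInf_sq_ne_zero {q : ℂ} (hq : ‖q‖ < 1) : qPochInf (q ^ 2) (q ^ 2) ≠ 0 := fun h => by
  have h1 := ((tendsto_qPoch (norm_sq_lt_one hq) (q ^ 2)).norm.const_mul (prodBound ‖q‖))
  have h2 := ge_of_tendsto' h1 fun n => one_le_prodBound_mul_norm_qPoch hq (norm_sq_le hq) n
  rw [h, norm_zero, mul_zero] at h2
  linarith

lemma tendsto_invQFact {q : ℂ} (hq : ‖q‖ < 1) {g : ℕ → ℤ}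
    (hg : Filter.Tendsto g Filter.atTop Filter.atTop) :
    Filter.Tendsto (fun n => invQFact q (g n)) Filter.atTop
      (nhds (qPochInf (q ^ 2) (q ^ 2))⁻¹) := by
  have h1 : Filter.Tendsto (fun k : ℤ => k.toNat) Filter.atTop Filter.atTop :=
    Filter.tendsto_atTop.2 fun b => Filter.eventually_atTop.2 ⟨b, fun k hk => by omega⟩
  have h2 := (((tendsto_qPoch (norm_sq_lt_one hq) (q ^ 2)).inv₀ (qPochInf_sq_ne_zero hq)).comp
    h1).comp hg
  refine h2.congr' ?_
  filter_upwards [hg.eventually_ge_atTop 0] with n hn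
  simp [invQFact, hn]

/-- The Jacobi triple product identity for `j(q; q²)`. -/
lemma tsum_eq_thetaJ {q : ℂ} (h0 : q ≠ 0) (hq : ‖q‖ < 1) :
    ∑' a : ℤ, (-1) ^ a * q ^ (a ^ 2) = thetaJ q (q ^ 2) := by
  set L := qPochInf (q ^ 2) (q ^ 2) with hL
  have hL0 : L ≠ 0 := qPochInf_sq_ne_zero hq
  have hK := prodBound_pos ‖q‖
  have h1 : Filter.Tendsto (fun n : ℕ => ∑' a : ℤ, (-1) ^ a * q ^ (a ^ 2) *
      (invQFact q (n + a) * invQFact q (n - a))) Filter.atTop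
      (nhds (∑' a : ℤ, (-1) ^ a * q ^ (a ^ 2) * (L⁻¹ * L⁻¹))) := by
    refine tendsto_tsum_of_dominated_convergence
      (bound := fun a : ℤ => prodBound ‖q‖ ^ 2 * ‖q‖ ^ a.natAbs)
      ((summable_pow_natAbs (norm_nonneg q) hq).mul_left _) (fun a => ?_)
      (Filter.Eventually.of_forall fun n a => ?_)
    · refine ((tendsto_invQFact hq ?_).mul (tendsto_invQFact hq ?_)).const_mul _
      · exact Filter.tendsto_atTop_add_const_right _ a tendsto_natCast_atTop_atTop
      · exact Filter.tendsto_atTop_add_const_right _ (-a) tendsto_natCast_atTop_atTop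
    · rw [zpow_sq_eq_natAbs, neg_one_zpow_eq_natAbs, norm_mul, norm_mul, norm_mul, norm_pow,
        norm_pow, norm_neg, norm_one, one_pow, one_mul, mul_comm, pow_two (prodBound _)]
      refine mul_le_mul (mul_le_mul (norm_invQFact_le hq _) (norm_invQFact_le hq _)
        (norm_nonneg _) hK.le) (pow_le_pow_of_le_one (norm_nonneg _) hq.le ?_) (by positivity)
        (by positivity)
      exact Nat.le_self_pow (by norm_num) _
  have h2 : Filter.Tendsto (fun n : ℕ => ∑' a : ℤ, (-1) ^ a * q ^ (a ^ 2) *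
      (invQFact q (n + a) * invQFact q (n - a))) Filter.atTop
      (nhds (L⁻¹ * (qPochInf q (q ^ 2) * qPochInf q (q ^ 2)))) := by
    simp_rw [fun n : ℕ => (hasSum_finite_triple h0 hq n n).tsum_eq]
    have h3 := tendsto_qPoch (norm_sq_lt_one hq) q
    refine (tendsto_invQFact hq ?_).mul (h3.mul h3)
    exact tendsto_natCast_atTop_atTop.atTop_add_atTop tendsto_natCast_atTop_atTop
  have h3 := tendsto_nhds_unique h1 h2
  rw [tsum_mul_right] at h3
  rw [thetaJ, show q ^ 2 / q = q by field_simp, ← hL]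
  field_simp at h3
  linear_combination h3

lemma hasSum_natAbs {f : ℕ → ℂ} (hf : Summable f) :
    HasSum (fun a : ℤ => f a.natAbs) (2 * ∑' n, f n - f 0) := by
  have h : HasSum (fun a : ℤ => f a.natAbs) (∑' n, f n + ∑' n, f n - f ((0 : ℤ).natAbs)) :=
    HasSum.of_nat_of_neg (by simpa using hf.hasSum) (by simpa using hf.hasSum)
  rwa [← two_mul] at h

lemma coneTerm_zero_left (q : ℂ) (b : ℕ) : coneTerm q 0 b = (-1) ^ b * q ^ (2 * b ^ 2) := by
  simp [coneTerm]

lemma coneTerm_zero_right (q : ℂ) (a : ℕ) : coneTerm q a 0 = q ^ (a ^ 2) := by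
  simp [coneTerm]

lemma thetaJ_eq {q : ℂ} (h0 : q ≠ 0) (hq : ‖q‖ < 1) :
    thetaJ (q ^ 2) (q ^ 4) = 2 * ∑' b, coneTerm q 0 b - 1 := by
  have h1 := tsum_eq_thetaJ (pow_ne_zero 2 h0) (norm_sq_lt_one hq)
  rw [show q ^ 4 = (q ^ 2) ^ 2 by ring, ← h1]
  have h2 := (hasSum_natAbs (summable_coneTerm hq 0)).tsum_eq
  rw [coneTerm_zero_right] at h2
  rw [show (2 * ∑' b, coneTerm q 0 b - 1 : ℂ) = 2 * ∑' b, coneTerm q 0 b - q ^ (0 ^ 2) by simp, ← h2]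
  refine tsum_congr fun a => ?_
  rw [zpow_sq_eq_natAbs, neg_one_zpow_eq_natAbs, coneTerm_zero_left, ← pow_mul]

/-! ### Sums over the cone 2|m| ≤ n. -/

lemma summable_coneTerm_prod {q : ℂ} (hq : ‖q‖ < 1) :
    Summable fun p : ℕ × ℕ => coneTerm q p.1 p.2 := by
  have hs : Summable fun p : ℕ × ℕ => ‖q‖ ^ p.1 * ‖q‖ ^ p.2 :=
    (summable_geometric_of_lt_one (norm_nonneg q) hq).mul_of_nonneg
      (summable_geometric_of_lt_one (norm_nonneg q) hq) (fun _ => by positivity)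
      (fun _ => by positivity)
  exact .of_norm_bounded hs fun p => norm_coneTerm_le hq _ _

lemma summable_coneTerm_natAbs {q : ℂ} (hq : ‖q‖ < 1) :
    Summable fun p : ℕ × ℤ => coneTerm q p.1 p.2.natAbs := by
  have hs : Summable fun p : ℕ × ℤ => ‖q‖ ^ p.1 * ‖q‖ ^ p.2.natAbs :=
    (summable_geometric_of_lt_one (norm_nonneg q) hq).mul_of_nonneg
      (summable_pow_natAbs (norm_nonneg q) hq) (fun _ => by positivity)
      (fun _ => by positivity)
  exact .of_norm_bounded hs fun p => norm_coneTerm_le hq _ _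

lemma summable_row {q : ℂ} (hq : ‖q‖ < 1) :
    Summable fun a => 2 * ∑' b, coneTerm q a b - q ^ (a ^ 2) := by
  have h2 : Summable fun a : ℕ => q ^ (a ^ 2) :=
    .of_norm_bounded (summable_geometric_of_lt_one (norm_nonneg q) hq) fun a => by
      rw [norm_pow]
      exact pow_le_pow_of_le_one (norm_nonneg _) hq.le (Nat.le_self_pow (by norm_num) _)
  exact ((summable_coneTerm_prod hq).prod.mul_left 2).sub h2

/-- The sum over the cone `{(n, m) | 2 |m| ≤ n}`. -/
noncomputable def coneSum (q : ℂ) : ℂ := ∑' p : ℕ × ℤ, coneTerm q p.1 p.2.natAbs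

lemma coneSum_eq {q : ℂ} (hq : ‖q‖ < 1) :
    coneSum q = ∑' a, (2 * ∑' b, coneTerm q a b - q ^ (a ^ 2)) := by
  rw [coneSum, (summable_coneTerm_natAbs hq).tsum_prod]
  refine tsum_congr fun a => ?_
  rw [(hasSum_natAbs (summable_coneTerm hq a)).tsum_eq, coneTerm_zero_right]

/-- Folding a ∈ ℤ onto ℕ counts the row a = 0 once rather than twice. Subtracting that row, 2T - 1
with T the sum of `coneTerm q 0 b`, and then the correction 1 leaves 2C - 2T, where C is `coneSum
q`. -/
lemma third_series_eq {q : ℂ} (h0 : q ≠ 0) (hq : ‖q‖ < 1) :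
    ∑' k : ℕ, (-1) ^ k * q ^ (2 * k + 1) *
        (qPoch q (q ^ 2) k / qPoch (-q) (q ^ 2) (k + 1)) =
      coneSum q - ∑' b, coneTerm q 0 b := by
  have h1 := two_mul_third_series h0 hq
  have h2 := hasSum_natAbs (summable_row hq)
  rw [(h2.sub (hasSum_ite_eq (0 : ℤ) (1 : ℂ))).tsum_eq, ← coneSum_eq hq] at h1
  simp at h1
  linear_combination h1 / 2

/-- The term `(-1)^m q^{n² - 2 m²}`. -/
noncomputable def formTerm (q : ℂ) (n m : ℤ) : ℂ := (-1) ^ m * q ^ (n ^ 2 - 2 * m ^ 2)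

/-- `(-1)^m q^{n² - 2 m²}` on the cone `2 |m| + d ≤ n`, and `0` elsewhere. -/
noncomputable def coneIndicator (q : ℂ) (d : ℕ) (p : ℕ × ℤ) : ℂ :=
  if 2 * p.2.natAbs + d ≤ p.1 then formTerm q p.1 p.2 else 0

lemma formTerm_eq_coneTerm (q : ℂ) (a : ℕ) (m : ℤ) :
    formTerm q ((a + 2 * m.natAbs : ℕ) : ℤ) m = coneTerm q a m.natAbs := by
  rw [formTerm, coneTerm, neg_one_zpow_eq_natAbs, ← zpow_natCast q]
  congr 2
  push_cast
  rw [← sq_abs m]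
  ring

lemma hasSum_coneIndicator_zero {q : ℂ} (hq : ‖q‖ < 1) :
    HasSum (coneIndicator q 0) (coneSum q) := by
  have hinj : Function.Injective fun p : ℕ × ℤ => (p.1 + 2 * p.2.natAbs, p.2) := by
    rintro ⟨a, m⟩ ⟨a', m'⟩ h
    simp only [Prod.mk.injEq] at h ⊢
    obtain ⟨h1, rfl⟩ := h
    exact ⟨by omega, rfl⟩
  refine (hinj.hasSum_iff fun p hp => ?_).1 ?_
  · rw [coneIndicator, if_neg]
    intro h
    exact hp ⟨(p.1 - 2 * p.2.natAbs, p.2), by ext <;> simp; omega⟩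
  · refine (summable_coneTerm_natAbs hq).hasSum.of_eq_of_eq (fun p => ?_) rfl
    simp only [Function.comp, coneIndicator]
    rw [if_pos (by omega), formTerm_eq_coneTerm]

/-- The points lost from the full cone are the boundary rays n = 2|m|, where n² - 2m² = 2m². -/
lemma hasSum_coneIndicator_one {q : ℂ} (hq : ‖q‖ < 1) :
    HasSum (coneIndicator q 1) (coneSum q - (2 * ∑' b, coneTerm q 0 b - 1)) := by
  have hinj : Function.Injective fun m : ℤ => (2 * m.natAbs, m) := fun m m' h => by
    simp only [Prod.mk.injEq] at h
    exact h.2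
  have h1 : HasSum (fun p : ℕ × ℤ => coneIndicator q 0 p - coneIndicator q 1 p)
      (2 * ∑' b, coneTerm q 0 b - 1) := by
    refine (hinj.hasSum_iff fun p hp => ?_).1 ?_
    · have h : p.1 ≠ 2 * p.2.natAbs := fun h => hp ⟨p.2, by ext <;> simp [h]⟩
      simp only [coneIndicator]
      split_ifs <;> first | omega | simp
    · refine (hasSum_natAbs (summable_coneTerm hq 0)).of_eq_of_eq (fun m => ?_) ?_
      · simp only [Function.comp, coneIndicator]
        rw [if_pos (by omega), if_neg (by omega), sub_zero, ← formTerm_eq_coneTerm, zero_add]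
      · simp [coneTerm]
  refine ((hasSum_coneIndicator_zero hq).sub h1).of_eq_of_eq (fun p => ?_) rfl
  ring

lemma innerSum_eq (q : ℂ) (n : ℕ) :
    HasSum (fun m : ℤ => coneIndicator q 0 (n, m)) (innerSum q n) := by
  have h : HasSum (fun m : ℤ => coneIndicator q 0 (n, m))
      (∑ m ∈ Finset.Icc (-((n : ℤ) / 2)) ((n : ℤ) / 2), coneIndicator q 0 (n, m)) := by
    refine hasSum_sum_of_ne_finset_zero fun m hm => ?_
    rw [Finset.mem_Icc] at hm
    simp only [coneIndicator]
    rw [if_neg (by omega)]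
  refine h.of_eq_of_eq (fun _ => rfl) (Finset.sum_congr rfl fun m hm => ?_)
  rw [Finset.mem_Icc] at hm
  simp only [coneIndicator]
  rw [if_pos (by omega), formTerm]

lemma hasSum_innerSum {q : ℂ} (hq : ‖q‖ < 1) : HasSum (innerSum q) (coneSum q) :=
  (hasSum_coneIndicator_zero hq).prod_fiberwise (innerSum_eq q)

/-! ### Hecke double sums as tilings of the cone. -/

/-- The substitution n = 2(r+s) + c, m = r - s diagonalises the form; m has the parity of r + s, so
the signs agree. -/
lemma heckeTerm_eq {q : ℂ} (h0 : q ≠ 0) (c : ℕ) (r s : ℤ) :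
    q ^ (c ^ 2) * heckeTerm 1 3 1 (q ^ (4 * c + 2)) (q ^ (4 * c + 2)) (q ^ 4) r s =
      formTerm q (2 * (r + s) + c) (r - s) := by
  have e1 : 2 * (r * (r - 1) / 2) = r * (r - 1) :=
    Int.mul_ediv_cancel' (Int.even_mul_pred_self r).two_dvd
  have e2 : 2 * (s * (s - 1) / 2) = s * (s - 1) :=
    Int.mul_ediv_cancel' (Int.even_mul_pred_self s).two_dvd
  have e3 : (-1 : ℂ) ^ (r + s) = (-1) ^ (r - s) := by
    rw [show r + s = r - s + 2 * s by ring, zpow_add₀ (by norm_num), zpow_mul]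
    norm_num
  rw [heckeTerm, formTerm, e3]
  have e4 : ∀ (k : ℕ) (j : ℤ), (q ^ k) ^ j = q ^ ((k : ℤ) * j) := fun k j => by
    rw [zpow_mul, zpow_natCast]
  rw [e4, e4, e4, ← zpow_natCast q (c ^ 2)]
  have e5 : (2 * (r + s) + c) ^ 2 - 2 * (r - s) ^ 2 = ((c ^ 2 : ℕ) : ℤ) +
      (((4 * c + 2 : ℕ) : ℤ) * r + (((4 * c + 2 : ℕ) : ℤ) * s + ((4 : ℕ) : ℤ) *
        (1 * (r * (r - 1) / 2) + 3 * r * s + 1 * (s * (s - 1) / 2)))) := by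
    push_cast
    linear_combination -2 * e1 - 2 * e2
  rw [e5, zpow_add₀ h0, zpow_add₀ h0, zpow_add₀ h0]
  ring

lemma formTerm_neg_left (q : ℂ) (n m : ℤ) : formTerm q (-n) m = formTerm q n m := by
  rw [formTerm, formTerm, neg_sq]

lemma formTerm_neg_right (q : ℂ) (n m : ℤ) : formTerm q n (-m) = formTerm q n m := by
  rw [formTerm, formTerm, neg_sq, neg_one_zpow_eq_natAbs, neg_one_zpow_eq_natAbs m, Int.natAbs_neg]

/-- Parametrization of the cone `2 |m| + d ≤ n`. -/
def coneMap (d : ℕ) (x : Fin 4 × ℕ × ℕ) : ℕ × ℤ :=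
  (2 * (x.2.1 + x.2.2) + (x.1 + d), (x.2.1 : ℤ) - x.2.2)

lemma coneMap_injective (d : ℕ) : Function.Injective (coneMap d) := by
  rintro ⟨c, k, l⟩ ⟨c', k', l'⟩ h
  simp only [coneMap, Prod.mk.injEq] at h
  have hc := c.2
  have hc' := c'.2
  simp only [Prod.mk.injEq, Fin.ext_iff]
  omega

lemma mem_range_coneMap {d n : ℕ} {m : ℤ} (h : 2 * m.natAbs + d ≤ n) :
    (n, m) ∈ Set.range (coneMap d) := by
  obtain ⟨k, l, c, hc, h1, h2⟩ : ∃ k l c : ℕ, c < 4 ∧ 2 * (k + l) + (c + d) = n ∧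
      (k : ℤ) - l = m := by
    -- Since n - d - 2|m| = 4 min(k,l) + c, the smaller coordinate and c are its quotient and
    -- remainder modulo 4.
    rcases le_total 0 m with hm | hm
    · exact ⟨(n - d - 2 * m.natAbs) / 4 + m.natAbs, (n - d - 2 * m.natAbs) / 4,
        (n - d - 2 * m.natAbs) % 4, by omega, by omega, by omega⟩
    · exact ⟨(n - d - 2 * m.natAbs) / 4, (n - d - 2 * m.natAbs) / 4 + m.natAbs,
        (n - d - 2 * m.natAbs) % 4, by omega, by omega, by omega⟩
  exact ⟨(⟨c, hc⟩, k, l), by simp only [coneMap, h1, h2]⟩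

lemma hasSum_formTerm_coneMap {q s : ℂ} {d : ℕ} (h : HasSum (coneIndicator q d) s) :
    HasSum (fun x => formTerm q (coneMap d x).1 (coneMap d x).2) s := by
  refine (((coneMap_injective d).hasSum_iff fun p hp => ?_).2 h).of_eq_of_eq (fun x => ?_) rfl
  · rw [coneIndicator, if_neg]
    exact fun h => hp (mem_range_coneMap h)
  · simp only [Function.comp, coneIndicator]
    rw [if_pos]
    simp only [coneMap]
    omega

lemma summable_of_pow_mul {ι : Type*} {q : ℂ} (h0 : q ≠ 0) {f g : ι → ℂ} (c : ℕ)
    (hg : Summable g) (h : ∀ i, q ^ c * f i = g i) : Summable f :=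
  (hg.mul_left (q ^ c)⁻¹).congr fun i => by rw [← h, inv_mul_cancel_left₀ (pow_ne_zero c h0)]

lemma pow_mul_heckeTerm_nonneg {q : ℂ} (h0 : q ≠ 0) (c : Fin 4) (p : ℕ × ℕ) :
    q ^ ((c : ℕ) ^ 2) * heckeTerm 1 3 1 (q ^ (4 * (c : ℕ) + 2)) (q ^ (4 * (c : ℕ) + 2)) (q ^ 4)
      p.1 p.2 = formTerm q (coneMap 0 (c, p)).1 (coneMap 0 (c, p)).2 := by
  rw [heckeTerm_eq h0]
  simp [coneMap]

/-- At r = -(k+1), s = -(l+1), the value n = 2(r+s) + (3 - c) is -(2(k+l) + c + 1). After a sign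
change the negative quadrant thus fills the open cone, with the residues in reversed order. -/
lemma pow_mul_heckeTerm_neg {q : ℂ} (h0 : q ≠ 0) (c : Fin 4) (p : ℕ × ℕ) :
    q ^ ((3 - (c : ℕ)) ^ 2) * heckeTerm 1 3 1 (q ^ (4 * (3 - (c : ℕ)) + 2))
      (q ^ (4 * (3 - (c : ℕ)) + 2)) (q ^ 4) (-((p.1 : ℤ) + 1)) (-((p.2 : ℤ) + 1)) =
      formTerm q (coneMap 1 (c, p)).1 (coneMap 1 (c, p)).2 := by
  have hc := c.2
  rw [heckeTerm_eq h0, ← formTerm_neg_left, ← formTerm_neg_right]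
  simp only [coneMap]
  congr 1
  · push_cast [show (c : ℕ) ≤ 3 by omega]; ring
  · ring

lemma heckeConverges {q : ℂ} (h0 : q ≠ 0) (hq : ‖q‖ < 1) {c : ℕ} (hc : c < 4) :
    HeckeConverges 1 3 1 (q ^ (4 * c + 2)) (q ^ (4 * c + 2)) (q ^ 4) := by
  have h1 := (hasSum_formTerm_coneMap (hasSum_coneIndicator_zero hq)).summable
  have h2 := (hasSum_formTerm_coneMap (hasSum_coneIndicator_one hq)).summable
  refine ⟨summable_of_pow_mul h0 _ (h1.prod_factor ⟨c, hc⟩)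
    (pow_mul_heckeTerm_nonneg h0 ⟨c, hc⟩), ?_⟩
  have h3 := pow_mul_heckeTerm_neg h0 ⟨3 - c, by omega⟩
  simp only [show 3 - (3 - c) = c by omega] at h3
  exact summable_of_pow_mul h0 _ (h2.prod_factor ⟨3 - c, by omega⟩) h3

lemma sum_heckeG {q : ℂ} (h0 : q ≠ 0) (hq : ‖q‖ < 1) :
    q * heckeG 1 3 1 (q ^ 6) (q ^ 6) (q ^ 4) + heckeG 1 3 1 (q ^ 2) (q ^ 2) (q ^ 4)
        + q ^ 4 * heckeG 1 3 1 (q ^ 10) (q ^ 10) (q ^ 4)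
        + q ^ 9 * heckeG 1 3 1 (q ^ 14) (q ^ 14) (q ^ 4) =
      2 * coneSum q - (2 * ∑' b, coneTerm q 0 b - 1) := by
  have h1 := hasSum_formTerm_coneMap (hasSum_coneIndicator_zero hq)
  have h2 := hasSum_formTerm_coneMap (hasSum_coneIndicator_one hq)
  have e1 := h1.tsum_eq
  have e2 := h2.tsum_eq
  rw [h1.summable.tsum_prod, tsum_fintype, Fin.sum_univ_four] at e1
  rw [h2.summable.tsum_prod, tsum_fintype, Fin.sum_univ_four] at e2
  simp_rw [← pow_mul_heckeTerm_nonneg h0, tsum_mul_left] at e1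
  simp_rw [← pow_mul_heckeTerm_neg h0, tsum_mul_left] at e2
  simp [-neg_add_rev] at e1 e2
  simp only [heckeG]
  linear_combination e1 + e2

/-! ### Assembly of the convergence claims and the chain of equalities. -/

theorem mainTheorem2 (q : ℂ) (hq0 : 0 < ‖q‖) (hq1 : ‖q‖ < 1) :
    -- all the series and products that occur converge
    ((Summable fun n : ℕ+ =>
        q ^ ((n : ℕ) ^ 2) / (qPoch (-q) (q ^ 2) n * (1 + q ^ (2 * (n : ℕ))))) ∧
      (Summable fun n : ℕ+ =>
        (-1) ^ ((n : ℕ) - 1) * q ^ (n : ℕ) * qPoch (q ^ 2) (q ^ 2) ((n : ℕ) - 1) /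
          qPoch (-q ^ 2) (q ^ 2) n) ∧
      (Summable fun n : ℕ+ => innerSum q n) ∧
      (Summable fun n : ℕ+ => (-1) ^ (n : ℕ) * q ^ (2 * (n : ℕ) ^ 2)) ∧
      HeckeConverges 1 3 1 (q ^ 6) (q ^ 6) (q ^ 4) ∧
      HeckeConverges 1 3 1 (q ^ 2) (q ^ 2) (q ^ 4) ∧
      HeckeConverges 1 3 1 (q ^ 10) (q ^ 10) (q ^ 4) ∧
      HeckeConverges 1 3 1 (q ^ 14) (q ^ 14) (q ^ 4) ∧
      (∀ x : ℂ, Multipliable fun i : ℕ => 1 - (q ^ 4) ^ i * x)) ∧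
    -- and the chain of equalities holds
    (∑' n : ℕ+, q ^ ((n : ℕ) ^ 2) / (qPoch (-q) (q ^ 2) n * (1 + q ^ (2 * (n : ℕ)))) =
      ∑' n : ℕ+, (-1) ^ ((n : ℕ) - 1) * q ^ (n : ℕ) * qPoch (q ^ 2) (q ^ 2) ((n : ℕ) - 1) /
        qPoch (-q ^ 2) (q ^ 2) n) ∧
    (∑' n : ℕ+, (-1) ^ ((n : ℕ) - 1) * q ^ (n : ℕ) * qPoch (q ^ 2) (q ^ 2) ((n : ℕ) - 1) /
        qPoch (-q ^ 2) (q ^ 2) n =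
      (∑' n : ℕ+, innerSum q n) - (∑' n : ℕ+, (-1) ^ (n : ℕ) * q ^ (2 * (n : ℕ) ^ 2))) ∧
    ((∑' n : ℕ+, innerSum q n) - (∑' n : ℕ+, (-1) ^ (n : ℕ) * q ^ (2 * (n : ℕ) ^ 2)) =
      1 / 2 * (q * heckeG 1 3 1 (q ^ 6) (q ^ 6) (q ^ 4) + heckeG 1 3 1 (q ^ 2) (q ^ 2) (q ^ 4)
        + q ^ 4 * heckeG 1 3 1 (q ^ 10) (q ^ 10) (q ^ 4)
        + q ^ 9 * heckeG 1 3 1 (q ^ 14) (q ^ 14) (q ^ 4) + thetaJ (q ^ 2) (q ^ 4))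
        - 1 - (∑' n : ℕ+, (-1) ^ (n : ℕ) * q ^ (2 * (n : ℕ) ^ 2))) ∧
    (1 / 2 * (q * heckeG 1 3 1 (q ^ 6) (q ^ 6) (q ^ 4) + heckeG 1 3 1 (q ^ 2) (q ^ 2) (q ^ 4)
        + q ^ 4 * heckeG 1 3 1 (q ^ 10) (q ^ 10) (q ^ 4)
        + q ^ 9 * heckeG 1 3 1 (q ^ 14) (q ^ 14) (q ^ 4) + thetaJ (q ^ 2) (q ^ 4))
        - 1 - (∑' n : ℕ+, (-1) ^ (n : ℕ) * q ^ (2 * (n : ℕ) ^ 2)) =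
      1 / 2 * (q * heckeG 1 3 1 (q ^ 6) (q ^ 6) (q ^ 4) + heckeG 1 3 1 (q ^ 2) (q ^ 2) (q ^ 4)
        + q ^ 4 * heckeG 1 3 1 (q ^ 10) (q ^ 10) (q ^ 4)
        + q ^ 9 * heckeG 1 3 1 (q ^ 14) (q ^ 14) (q ^ 4) - 1)) := by
  have h0 : q ≠ 0 := norm_pos_iff.1 hq0
  have hinner := hasSum_innerSum hq1
  have hinner0 : innerSum q 0 = 1 := by simp [innerSum]
  have hth := summable_coneTerm hq1 0
  have s1 : Summable fun n : ℕ+ =>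
      q ^ ((n : ℕ) ^ 2) / (qPoch (-q) (q ^ 2) n * (1 + q ^ (2 * (n : ℕ)))) :=
    (summable_pnat_iff_summable_succ (f := fun n : ℕ =>
      q ^ (n ^ 2) / (qPoch (-q) (q ^ 2) n * (1 + q ^ (2 * n))))).2 (summable_sq_series hq1)
  have s2 : Summable fun n : ℕ+ =>
      (-1) ^ ((n : ℕ) - 1) * q ^ (n : ℕ) * qPoch (q ^ 2) (q ^ 2) ((n : ℕ) - 1) /
        qPoch (-q ^ 2) (q ^ 2) n :=
    (summable_pnat_iff_summable_succ (f := fun n : ℕ =>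
      (-1) ^ (n - 1) * q ^ n * qPoch (q ^ 2) (q ^ 2) (n - 1) / qPoch (-q ^ 2) (q ^ 2) n)).2
      (summable_alternating_series hq1)
  have s3 : Summable fun n : ℕ+ => innerSum q n :=
    summable_pnat_iff_summable_succ.2 ((summable_nat_add_iff 1).2 hinner.summable)
  have s4 : Summable fun n : ℕ+ => (-1) ^ (n : ℕ) * q ^ (2 * (n : ℕ) ^ 2) := by
    refine (summable_pnat_iff_summable_succ (f := fun n : ℕ => (-1) ^ n * q ^ (2 * n ^ 2))).2 ?_
    exact ((summable_nat_add_iff 1).2 hth).congr fun n => coneTerm_zero_left q (n + 1)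
  have t1 : ∑' n : ℕ+, q ^ ((n : ℕ) ^ 2) / (qPoch (-q) (q ^ 2) n * (1 + q ^ (2 * (n : ℕ)))) =
      q / (1 + q ^ 2) * fineSum q (q ^ 2) (-q ^ 4) (-q) :=
    (tsum_pnat_eq_tsum_succ (f := fun n : ℕ =>
      q ^ (n ^ 2) / (qPoch (-q) (q ^ 2) n * (1 + q ^ (2 * n))))).trans (tsum_sq_series h0 hq1)
  have t2 : ∑' n : ℕ+, (-1) ^ ((n : ℕ) - 1) * q ^ (n : ℕ) *
      qPoch (q ^ 2) (q ^ 2) ((n : ℕ) - 1) / qPoch (-q ^ 2) (q ^ 2) n =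
      q / (1 + q ^ 2) * fineSum q (q ^ 2) (-q ^ 4) (-q) :=
    (tsum_pnat_eq_tsum_succ (f := fun n : ℕ =>
      (-1) ^ (n - 1) * q ^ n * qPoch (q ^ 2) (q ^ 2) (n - 1) / qPoch (-q ^ 2) (q ^ 2) n)).trans
      tsum_alternating_series
  -- The cone contains its vertex n = m = 0, which the series over n ≥ 1 omits.
  have t3 : ∑' n : ℕ+, innerSum q n = coneSum q - 1 := by
    have h := hinner.summable.tsum_eq_zero_add
    rw [hinner.tsum_eq, hinner0] at h
    rw [tsum_pnat_eq_tsum_succ (f := innerSum q), h, add_sub_cancel_left]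
  have t4 : ∑' n : ℕ+, (-1) ^ (n : ℕ) * q ^ (2 * (n : ℕ) ^ 2) = ∑' b, coneTerm q 0 b - 1 := by
    rw [tsum_pnat_eq_tsum_succ (f := fun n : ℕ => (-1) ^ n * q ^ (2 * n ^ 2)),
      hth.tsum_eq_zero_add]
    simp_rw [coneTerm_zero_left]
    simp
  have t5 := (mul_fineSum_eq_tsum hq1).trans (third_series_eq h0 hq1)
  refine ⟨⟨s1, s2, s3, s4, heckeConverges h0 hq1 (c := 1) (by norm_num),
    heckeConverges h0 hq1 (c := 0) (by norm_num), heckeConverges h0 hq1 (c := 2) (by norm_num),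
    heckeConverges h0 hq1 (c := 3) (by norm_num), qPochInf_multipliable ?_⟩, ?_, ?_, ?_, ?_⟩
  · rw [norm_pow]
    exact pow_lt_one₀ (norm_nonneg _) hq1 (by norm_num)
  · rw [t1, t2]
  · rw [t2, t3, t4, t5]
    ring
  · rw [t3, t4, sum_heckeG h0 hq1, thetaJ_eq h0 hq1]
    ring
  · rw [t4, thetaJ_eq h0 hq1]
    ring
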